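/- Let $m\ge 1$ and let $\rho,\nu:\mathbb{R}^m\to(0,\infty)$ be real analytic. Put $c=\sqrt{\nu/\rho}$, $n=1/c=\sqrt{\rho/\nu}$, and write $\rho_0,\nu_0,c_0,n_0$ for the values at the source $0$. Let $$\tau(x)=\inf_\gamma\int_0^1 n(\gamma(s))\,|\gamma'(s)|\,ds$$ be the least traveltime from $0$ to $x$ (infimum over $C^1$ paths $\gamma$ with $\gamma(0)=0$, $\gamma(1)=x$). Let $\bar T>0$ be such that no caustic other than the source occurs before time $\bar T$, in the sense that $\tau^2$ is $C^\infty$ on $\{\tau<\bar T\}$. Let $v_0$ be a real $C^\infty$ function on $\{\tau<\bar T\}$ (for instance a smooth solution there of the leading transport equation $2\nu\,\nabla\tau^2\cdot\nabla v_0+[\nabla\cdot(\nu\nabla\tau^2)-2m\rho]\,v_0=0$). For $\operatorname{Re}\lambda>-1$ let $f_+^\lambda(\varsigma)=\varsigma_+^\lambda/\Gamma(\lambda+1)$. For $0<t<\bar T$ and $\phi\in C_c^\infty(\mathbb{R}^m)$, the leading term $G_0(t,\cdot)=v_0\,f_+^{-(m-1)/2}[t^2-\tau^2]$ of Hadamard's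 ansatz is defined by letting $\langle G_0(t,\cdot),\phi\rangle$ be the value at $\lambda=-\frac{m-1}{2}$ of the analytic continuation in $\lambda$ of $$\int_{\mathbb{R}^m} v_0(x)\,f_+^{\lambda}[t^2-\tau^2(x)]\,\phi(x)\,dx,\qquad \operatorname{Re}\lambda>-1,$$ and $\langle\partial_tG_0(t,\cdot),\phi\rangle=\frac{d}{dt}\langle G_0(t,\cdot),\phi\rangle$. Then, for every $m\ge1$, even or odd: 1. For all $\phi\in C_c^\infty(\mathbb{R}^m)$ and $0<t<\bar T$, the integral converges absolutely for $\operatorname{Re}\lambda>-1$ and extends to an entire function of $\lambda$, and $\langle G_0(t,\cdot),\phi\rangle$ is differentiable in $t$ on $(0,\bar T)$. 2. As $t\to0^+$, in the sense of distributions (i.e. after pairing with each $\phi$), $$G_0(t,\cdot)\to 0,\qquad \partial_tG_0(t,\cdot)\to 2c_0^m\pi^{\frac{m-1}{2}}v_0(0)\,\delta .$$ More precisely, for each $\phi$, as $t\to0^+$, $$\langle G_0(t,\cdot),\phi\rangle=2c_0^m\pi^{\frac{m-1}{2}}v_0(0)\phi(0)\,t+O(t^2),\qquad \langle\partial_tG_0(t,\cdot),\phi\rangle=2c_0^m\pi^{\frac{m-1}{2}}v_0(0)\phi(0)+O(t).$$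 3. Consequently $G_0$ satisfies the initial conditions of the Green's function of $\rho u_{tt}-\nabla\cdot(\nu\nabla u)=0$, namely $G_0(t,\cdot)\to0$ and $\partial_tG_0(t,\cdot)\to\frac1{\rho_0}\delta$ as $t\to0^+$ in the sense of distributions, if and only if $$v_0(0)=C_m:=\frac{n_0^m}{2\rho_0\pi^{\frac{m-1}{2}}},$$ and $$C_m=\frac{1}{2\rho_0c_0^m\pi^{\frac{m-1}{2}}}=\frac{1}{2\nu_0c_0^{m-2}\pi^{\frac{m-1}{2}}}=\frac{n_0^{m-2}}{2\nu_0\pi^{\frac{m-1}{2}}}.$$ -/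

import Mathlib

open Set Filter Topology MeasureTheory Asymptotics
open scoped ContDiff Distributions

noncomputable section

namespace HadamardAnsatz

/-- Wave speed `c = √(ν/ρ)` of the equation `ρ u_tt - ∇·(ν ∇u) = 0`. -/
def waveSpeed {m : ℕ} (ρ ν : EuclideanSpace ℝ (Fin m) → ℝ) (x : EuclideanSpace ℝ (Fin m)) : ℝ :=
  Real.sqrt (ν x / ρ x)

/-- Slowness `n = √(ρ/ν) = 1/c`. -/
def slowness {m : ℕ} (ρ ν : EuclideanSpace ℝ (Fin m) → ℝ) (x : EuclideanSpace ℝ (Fin m)) : ℝ :=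
  Real.sqrt (ρ x / ν x)

/-- Traveltime (phase function) `τ(x)`: the least time needed to go from the source `0` to `x`
at speed `c`, i.e. the infimum of `∫₀¹ n(γ(s)) |γ'(s)| ds` over `C¹` paths from `0` to `x`. -/
def travelTime {m : ℕ} (ρ ν : EuclideanSpace ℝ (Fin m) → ℝ)
    (x : EuclideanSpace ℝ (Fin m)) : ℝ :=
  sInf {L : ℝ | ∃ γ : ℝ → EuclideanSpace ℝ (Fin m), ContDiff ℝ 1 γ ∧ γ 0 = 0 ∧ γ 1 = x ∧
    L = ∫ s in (0 : ℝ)..1, slowness ρ ν (γ s) * ‖deriv γ s‖}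

/-- The neighbourhood `{τ < T}` of the source. -/
def sourceNhd {m : ℕ} (ρ ν : EuclideanSpace ℝ (Fin m) → ℝ) (T : ℝ) :
    Set (EuclideanSpace ℝ (Fin m)) :=
  {x | travelTime ρ ν x < T}

/-- No caustic occurs before time `T`, apart from the source itself: the squared traveltime is
smooth on `{τ < T}`. (This holds whenever the geodesic polar transformation
`x ↦ y = τ ω` is a diffeomorphism of `{τ < T}`, since then `τ² = |y|²`.) -/
def CausticFree {m : ℕ} (ρ ν : EuclideanSpace ℝ (Fin m) → ℝ) (T : ℝ) : Prop :=
  0 < T ∧ ContDiffOn ℝ ∞ (fun x => travelTime ρ ν x ^ 2) (sourceNhd ρ ν T)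

/-- The function `f_+^z(s) = s_+^z / z!`, with `z! = Γ(z+1)`; used for `Re z > -1`. -/
def gsFun (z : ℂ) (s : ℝ) : ℂ :=
  if 0 < s then (s : ℂ) ^ z / Complex.Gamma (z + 1) else 0

/-- `F` is the analytic continuation in `z` of `∫ f_+^z[P(x)] ψ(x) dx` from the half-plane
`Re z > -1`, where the integral is required to converge absolutely, to an entire function. -/
def IsGSPairing {m : ℕ} (P ψ : EuclideanSpace ℝ (Fin m) → ℝ) (F : ℂ → ℂ) : Prop :=
  Differentiable ℂ F ∧ ∀ z : ℂ, -1 < z.re →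
    Integrable (fun x => gsFun z (P x) * (ψ x : ℂ)) ∧
    F z = ∫ x, gsFun z (P x) * (ψ x : ℂ)

/-- The analytic continuation is unique. -/
theorem IsGSPairing.unique {m : ℕ} {P ψ : EuclideanSpace ℝ (Fin m) → ℝ} {F G : ℂ → ℂ}
    (hF : IsGSPairing P ψ F) (hG : IsGSPairing P ψ G) : F = G := by
  have hF' : AnalyticOnNhd ℂ F univ := fun z _ => hF.1.analyticAt z
  have hG' : AnalyticOnNhd ℂ G univ := fun z _ => hG.1.analyticAt z
  refine hF'.eq_of_eventuallyEq (z₀ := 0) hG' ?_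
  have hopen : {z : ℂ | -1 < z.re} ∈ 𝓝 (0 : ℂ) :=
    (isOpen_lt continuous_const Complex.continuous_re).mem_nhds (by simp)
  filter_upwards [hopen] with z hz
  rw [(hF.2 z hz).2, (hG.2 z hz).2]

open Classical in
/-- The pairing `∫ f_+^z[P(x)] ψ(x) dx` for every complex `z`, by analytic continuation
(with value `0` if there is no continuation). -/
def gsPairing {m : ℕ} (z : ℂ) (P ψ : EuclideanSpace ℝ (Fin m) → ℝ) : ℂ :=
  if h : ∃ F, IsGSPairing P ψ F then h.choose z else 0

/-- The function `t² - τ²(x)` of `x`. -/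
def phase {m : ℕ} (ρ ν : EuclideanSpace ℝ (Fin m) → ℝ) (t : ℝ)
    (x : EuclideanSpace ℝ (Fin m)) : ℝ :=
  t ^ 2 - travelTime ρ ν x ^ 2

/-- The leading term `G₀(t,·) = v₀ f_+^{-(m-1)/2}[t² - τ²]` of Hadamard's ansatz, applied to the
test function `φ`: the number `∫ G₀(t,x) φ(x) dx`. -/
def leadingTerm {m : ℕ} (ρ ν v₀ : EuclideanSpace ℝ (Fin m) → ℝ) (t : ℝ)
    (φ : 𝓓((⊤ : TopologicalSpace.Opens (EuclideanSpace ℝ (Fin m))), ℝ)) : ℂ :=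
  gsPairing (-((m : ℂ) - 1) / 2) (phase ρ ν t) (fun x => v₀ x * φ x)

/-- The time derivative `∂ₜG₀(t,·)`, applied to the test function `φ`. -/
def leadingTermDot {m : ℕ} (ρ ν v₀ : EuclideanSpace ℝ (Fin m) → ℝ) (t : ℝ)
    (φ : 𝓓((⊤ : TopologicalSpace.Opens (EuclideanSpace ℝ (Fin m))), ℝ)) : ℂ :=
  deriv (fun s : ℝ => leadingTerm ρ ν v₀ s φ) t

/-- `u(t,·) → a δ` in the sense of distributions as `t → 0⁺`. -/
def TendstoDelta {m : ℕ}
    (u : ℝ → 𝓓((⊤ : TopologicalSpace.Opens (EuclideanSpace ℝ (Fin m))), ℝ) → ℂ) (a : ℝ) : Prop :=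
  ∀ φ, Tendsto (fun t => u t φ) (𝓝[>] 0) (𝓝 (((a * φ 0 : ℝ)) : ℂ))

/-- `u(t,·) → 0` in the sense of distributions as `t → 0⁺`. -/
def TendstoZero {m : ℕ}
    (u : ℝ → 𝓓((⊤ : TopologicalSpace.Opens (EuclideanSpace ℝ (Fin m))), ℝ) → ℂ) : Prop :=
  ∀ φ, Tendsto (fun t => u t φ) (𝓝[>] 0) (𝓝 0)

end HadamardAnsatz

end

/-!
Write `q = τ²`. A path from the source to `x` can be prolonged by a segment, and conversely it
must cross every small sphere about `x`; so `τ` is locally Lipschitz and satisfies the eikonal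
equation `|∇τ| = n` wherever it is differentiable (`norm_eq_of_hasFDerivAt_leastTime`). For `q` it
reads `|∇q|² = 4 n² q`, and it says that the field `W = (ν / 2ρ) ∇q`, which is smooth wherever `q`
is, the source included, satisfies `W · ∇q = 2 q` (`exists_squaredPhase`). Thus `W` is the Euler
field of `q`, and no Morse or geodesic polar coordinates are needed.

Applying the divergence theorem to `f₊^(z+1)[t² - q] ψ W` and splitting `t² = (t² - q) + q` gives,
with `D ψ = ½ ∇ · (ψ W)`, the recursion

  `t² ⟨f₊^z[t² - q], ψ⟩ = (z + 1) ⟨f₊^(z+1)[t² - q], ψ⟩ + ⟨f₊^(z+1)[t² - q], D ψ⟩`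

for `Re z > -1` (`IsAmplitude.sq_mul_gsIntegral`). The divergence theorem, applied to `C¹`
regularizations of the power, also bounds their integrals, and this yields the absolute
convergence for `-1 < Re z`. The recursion continues the pairing to an entire function of `z`
(`differentiable_gsCont`) and carries two facts from large exponents, where they are elementary,
to all exponents. One is `d/dt ⟨f₊^(z+1)[t² - q], ψ⟩ = 2 t ⟨f₊^z[t² - q], ψ⟩`
(`hasDerivAt_gsCont_add_one`). The other is the behaviour as `t → 0⁺` in dimension `d`,

  `⟨f₊^p[t² - q], ψ⟩ = π^(d/2) / (n₀^d Γ(p + 1 + d/2)) ψ(0) t^(d + 2p) + O(t^(d + 2p + 1))`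

(`IsAmplitude.hasLeadingTerm`). For `p ≥ 1` this follows from `q = n₀² |x|² + O(|x|³)`, the
Lipschitz continuity of `f₊^p` and a Beta integral. To descend one needs `D ψ(0) = (d/2) ψ(0)`,
and this is forced by the recursion itself at the exponents `1` and `2`
(`IsAmplitude.dilation_zero`).

The leading term is the pairing at `p = -(m-1)/2`, where `d + 2p = 1` and `Γ(3/2) = √π / 2`; its
time derivative is `2 t` times the pairing at `p - 1`, where `Γ(1/2) = √π`. Both constants equal
`2 c₀^m π^((m-1)/2)`, whatever the parity of `m`.
-/

namespace HadamardAnsatz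

/-! ### Least traveltime along `C¹` paths -/

section LeastTime

variable {E : Type*} [NormedAddCommGroup E] [NormedSpace ℝ E]

/-- The least time needed to go from `0` to `x` in a medium of slowness `n`, along `C¹` paths. -/
noncomputable def leastTime (n : E → ℝ) (x : E) : ℝ :=
  sInf {L : ℝ | ∃ γ : ℝ → E, ContDiff ℝ 1 γ ∧ γ 0 = 0 ∧ γ 1 = x ∧
    L = ∫ s in (0 : ℝ)..1, n (γ s) * ‖deriv γ s‖}

variable {n : E → ℝ}

lemma leastTime_le_integral (hn : ∀ x, 0 < n x) {γ : ℝ → E} (hγ : ContDiff ℝ 1 γ) (h0 : γ 0 = 0) :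
    leastTime n (γ 1) ≤ ∫ s in (0 : ℝ)..1, n (γ s) * ‖deriv γ s‖ := by
  refine csInf_le ⟨0, ?_⟩ ⟨γ, hγ, h0, rfl, rfl⟩
  rintro _ ⟨δ, -, -, -, rfl⟩
  exact intervalIntegral.integral_nonneg zero_le_one
    fun _ _ => mul_nonneg (hn _).le (norm_nonneg _)

lemma le_leastTime {x : E} {c : ℝ}
    (h : ∀ γ : ℝ → E, ContDiff ℝ 1 γ → γ 0 = 0 → γ 1 = x →
      c ≤ ∫ s in (0 : ℝ)..1, n (γ s) * ‖deriv γ s‖) : c ≤ leastTime n x := by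
  refine le_csInf ⟨_, fun s => s • x, by fun_prop, by simp, by simp, rfl⟩ ?_
  rintro _ ⟨γ, hγ, h0, h1, rfl⟩
  exact h γ hγ h0 h1

lemma leastTime_nonneg (hn : ∀ x, 0 < n x) (x : E) : 0 ≤ leastTime n x :=
  le_leastTime fun _ _ _ _ => intervalIntegral.integral_nonneg zero_le_one
    fun _ _ => mul_nonneg (hn _).le (norm_nonneg _)

lemma leastTime_zero (hn : ∀ x, 0 < n x) : leastTime n 0 = 0 := by
  refine le_antisymm ?_ (leastTime_nonneg hn 0)
  simpa using leastTime_le_integral hn (γ := fun _ => (0 : E)) contDiff_const rfl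

lemma continuous_speed_integrand (hc : Continuous n) {γ : ℝ → E} (hγ : ContDiff ℝ 1 γ) :
    Continuous fun s => n (γ s) * ‖deriv γ s‖ :=
  (hc.comp hγ.continuous).mul (hγ.continuous_deriv le_rfl).norm

/-- The time spent on an initial piece of a path from the source is at least the least time. -/
lemma leastTime_le_integral_initial (hn : ∀ x, 0 < n x) {γ : ℝ → E}
    (hγ : ContDiff ℝ 1 γ) (h0 : γ 0 = 0) {s : ℝ} (hs : 0 ≤ s) :
    leastTime n (γ s) ≤ ∫ u in (0 : ℝ)..s, n (γ u) * ‖deriv γ u‖ := by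
  have hδ : ContDiff ℝ 1 (fun u => γ (s * u)) := hγ.comp (by fun_prop)
  have h := leastTime_le_integral hn hδ (by simpa using h0)
  have hder : ∀ u, deriv (fun u => γ (s * u)) u = s • deriv γ (s * u) := fun u => by
    simpa using deriv_comp_mul_left s γ u
  simp only [mul_one, hder, norm_smul, Real.norm_of_nonneg hs] at h
  refine h.trans_eq ?_
  have := intervalIntegral.mul_integral_comp_mul_left (a := (0 : ℝ)) (b := 1)
    (f := fun u => n (γ u) * ‖deriv γ u‖) s
  simp only [mul_zero, mul_one] at this
  rw [← this, ← intervalIntegral.integral_const_mul]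
  congr 1; ext u; ring

lemma mul_norm_sub_le_integral [CompleteSpace E] (hc : Continuous n) {γ : ℝ → E}
    (hγ : ContDiff ℝ 1 γ) {a b c : ℝ} (hab : a ≤ b) (hc0 : 0 ≤ c)
    (h : ∀ s ∈ Icc a b, c ≤ n (γ s)) :
    c * ‖γ b - γ a‖ ≤ ∫ u in a..b, n (γ u) * ‖deriv γ u‖ := by
  have hd := hγ.continuous_deriv le_rfl
  have h1 : ∫ u in a..b, deriv γ u = γ b - γ a :=
    intervalIntegral.integral_deriv_eq_sub
      (fun u _ => (hγ.differentiable one_ne_zero).differentiableAt)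
      (hd.intervalIntegrable _ _)
  rw [← h1]
  refine (mul_le_mul_of_nonneg_left
    (intervalIntegral.norm_integral_le_integral_norm hab) hc0).trans ?_
  rw [← intervalIntegral.integral_const_mul]
  refine intervalIntegral.integral_mono_on hab
    ((continuous_const.mul hd.norm).intervalIntegrable _ _)
    ((continuous_speed_integrand hc hγ).intervalIntegrable _ _) fun s hs => ?_
  exact mul_le_mul_of_nonneg_right (h s hs) (norm_nonneg _)

/-- First time at which a continuous function reaches the level `r`. -/
lemma exists_first_hitting {f : ℝ → ℝ} (hf : Continuous f) {r : ℝ} (h0 : f 0 ≤ r) (h1 : r ≤ f 1) :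
    ∃ s ∈ Icc (0 : ℝ) 1, f s = r ∧ ∀ u ∈ Icc 0 s, f u ≤ r := by
  have hK : IsCompact (Icc (0 : ℝ) 1 ∩ {s | r ≤ f s}) :=
    isCompact_Icc.inter_right (isClosed_le continuous_const hf)
  obtain ⟨s, ⟨hs, hrs⟩, hmin⟩ := hK.exists_isLeast ⟨1, ⟨by simp, h1⟩⟩
  have key : ∀ u ∈ Ico 0 s, f u < r := fun u hu => by
    by_contra hcon
    exact absurd (hmin ⟨⟨hu.1, hu.2.le.trans hs.2⟩, not_lt.1 hcon⟩) (not_le.2 hu.2)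
  have hfs : f s = r := by
    refine le_antisymm ?_ hrs
    by_contra hcon
    obtain ⟨u, hu, hur⟩ := intermediate_value_Icc hs.1 hf.continuousOn ⟨h0, (not_le.1 hcon).le⟩
    rcases hu.2.lt_or_eq with h | h
    · exact (key u ⟨hu.1, h⟩).ne hur
    · rw [h] at hur; exact hcon hur.le
  refine ⟨s, hs, hfs, fun u hu => ?_⟩
  rcases hu.2.lt_or_eq with h | h
  · exact (key u ⟨hu.1, h⟩).le
  · rw [h, hfs]

/-- A path from the source out of the ball of radius `r` spends at least the time `c r` before its
first exit. -/
lemma mul_le_leastTime [CompleteSpace E] (hn : ∀ x, 0 < n x) (hc : Continuous n) {r c : ℝ}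
    (hr : 0 ≤ r) (hc0 : 0 ≤ c) (h : ∀ y, ‖y‖ ≤ r → c ≤ n y) {x : E} (hx : r ≤ ‖x‖) :
    c * r ≤ leastTime n x := by
  refine le_leastTime fun γ hγ h0 h1 => ?_
  obtain ⟨s, hs, hsr, hsu⟩ := exists_first_hitting (f := fun s => ‖γ s‖) hγ.continuous.norm
    (r := r) (by simpa [h0] using hr) (by simpa [h1] using hx)
  have hI := continuous_speed_integrand hc hγ
  rw [← intervalIntegral.integral_add_adjacent_intervals (hI.intervalIntegrable 0 s)
    (hI.intervalIntegrable s 1)]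
  have h2 := mul_norm_sub_le_integral hc hγ hs.1 hc0 (fun u hu => h _ (hsu u hu))
  have h3 : 0 ≤ ∫ u in s..1, n (γ u) * ‖deriv γ u‖ :=
    intervalIntegral.integral_nonneg hs.2 fun _ _ => mul_nonneg (hn _).le (norm_nonneg _)
  rw [h0, sub_zero, hsr] at h2
  linarith

/-- A path from the source to `x` crosses the sphere of radius `r` about `x`, and from its last
crossing on it spends at least the time `c r`. -/
lemma add_mul_le_leastTime [CompleteSpace E] (hn : ∀ x, 0 < n x) (hc : Continuous n)
    {x : E} {r c A : ℝ} (hr : 0 ≤ r) (hrx : r ≤ ‖x‖) (hc0 : 0 ≤ c)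
    (h : ∀ y, ‖y - x‖ ≤ r → c ≤ n y) (hA : ∀ y, ‖y - x‖ = r → A ≤ leastTime n y) :
    A + c * r ≤ leastTime n x := by
  refine le_leastTime fun γ hγ h0 h1 => ?_
  obtain ⟨s, hs, hsr, hsu⟩ := exists_first_hitting (f := fun s => ‖γ (1 - s) - x‖)
    (by have := hγ.continuous; fun_prop) (r := r) (by simpa [h1] using hr) (by simpa [h0] using hrx)
  have hI := continuous_speed_integrand hc hγ
  rw [← intervalIntegral.integral_add_adjacent_intervals (hI.intervalIntegrable 0 (1 - s))
    (hI.intervalIntegrable (1 - s) 1)]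
  have h2 := mul_norm_sub_le_integral hc hγ (a := 1 - s) (b := 1) (by linarith [hs.1]) hc0
    (fun u hu => h _ (by simpa using hsu (1 - u) ⟨by linarith [hu.2], by linarith [hu.1]⟩))
  rw [h1, norm_sub_rev, hsr] at h2
  exact add_le_add ((hA _ hsr).trans
    (leastTime_le_integral_initial hn hγ h0 (by linarith [hs.2]))) h2

lemma deriv_smoothTransition_of_nonpos {u : ℝ} (hu : u ≤ 0) :
    deriv Real.smoothTransition u = 0 := by
  refine IsLocalMin.deriv_eq_zero (Eventually.of_forall fun v => ?_)
  rw [Real.smoothTransition.zero_of_nonpos hu]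
  exact Real.smoothTransition.nonneg v

lemma deriv_smoothTransition_of_one_le {u : ℝ} (hu : 1 ≤ u) :
    deriv Real.smoothTransition u = 0 := by
  refine IsLocalMax.deriv_eq_zero (Eventually.of_forall fun v => ?_)
  rw [Real.smoothTransition.one_of_one_le hu]
  exact Real.smoothTransition.le_one v

/-- A path to `x` can be continued along the segment from `x` to `y`; reparametrizing both pieces
so that they halt at the junction keeps the path `C¹`. -/
lemma leastTime_le_add_segment (hn : ∀ x, 0 < n x) (hc : Continuous n) {x y : E} {C : ℝ}
    (h : ∀ z ∈ segment ℝ x y, n z ≤ C) : leastTime n y ≤ leastTime n x + C * ‖y - x‖ := by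
  rw [← sub_le_iff_le_add]
  refine le_leastTime fun γ hγ h0 h1 => ?_
  rw [sub_le_iff_le_add]
  set η := Real.smoothTransition
  have hηd : ∀ u, HasDerivAt η (deriv η u) u := fun u =>
    ((Real.smoothTransition.contDiff (n := 1)).differentiable one_ne_zero u).hasDerivAt
  have hηc : Continuous (deriv η) :=
    (Real.smoothTransition.contDiff (n := 1)).continuous_deriv le_rfl
  have hη0 : ∀ u, 0 ≤ deriv η u := fun u => Real.smoothTransition.monotone.deriv_nonneg
  have ηneg : ∀ u ≤ 0, η u = 0 := fun u => Real.smoothTransition.zero_of_nonpos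
  have ηone : ∀ u, 1 ≤ u → η u = 1 := fun u => Real.smoothTransition.one_of_one_le
  have hηC : ContDiff ℝ 1 η := Real.smoothTransition.contDiff
  set δ : ℝ → E := fun s => γ (η (2 * s)) + η (2 * s - 1) • (y - x) with hδ
  have hδC : ContDiff ℝ 1 δ := by
    have h1 : ContDiff ℝ 1 fun s : ℝ => η (2 * s) := hηC.comp (by fun_prop)
    have h2 : ContDiff ℝ 1 fun s : ℝ => η (2 * s - 1) := hηC.comp (by fun_prop)
    exact (hγ.comp h1).add (h2.smul contDiff_const)
  have hd1 : ∀ s, HasDerivAt (fun s : ℝ => η (2 * s)) (2 * deriv η (2 * s)) s := fun s => by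
    have := (hηd (2 * s)).comp s ((hasDerivAt_id s).const_mul 2)
    simpa [Function.comp_def, mul_comm] using this
  have hd2 : ∀ s, HasDerivAt (fun s : ℝ => η (2 * s - 1)) (2 * deriv η (2 * s - 1)) s := fun s => by
    have := (hηd (2 * s - 1)).comp s (((hasDerivAt_id s).const_mul 2).sub_const 1)
    simpa [Function.comp_def, mul_comm] using this
  have hδd : ∀ s, deriv δ s = (2 * deriv η (2 * s)) • deriv γ (η (2 * s)) +
      (2 * deriv η (2 * s - 1)) • (y - x) := fun s => by
    have hγd := ((hγ.differentiable one_ne_zero) (η (2 * s))).hasDerivAt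
    exact ((hγd.scomp s (hd1 s)).add ((hd2 s).smul_const (y - x))).deriv
  have hδ0 : δ 0 = 0 := by
    simp [hδ, ηneg, h0]
  have hδ1 : δ 1 = y := by
    simp only [hδ]
    rw [ηone _ (by norm_num),
      ηone _ (by norm_num), h1]
    simp
  have hle := leastTime_le_integral hn hδC hδ0
  rw [hδ1] at hle
  refine hle.trans ?_
  have hI := continuous_speed_integrand hc hδC
  rw [← intervalIntegral.integral_add_adjacent_intervals (hI.intervalIntegrable 0 (1 / 2))
    (hI.intervalIntegrable (1 / 2) 1)]
  refine add_le_add (le_of_eq ?_) ?_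
  · have := intervalIntegral.integral_comp_mul_deriv (a := (0 : ℝ)) (b := 1 / 2)
      (f := fun s : ℝ => η (2 * s)) (f' := fun s => 2 * deriv η (2 * s))
      (g := fun s => n (γ s) * ‖deriv γ s‖) (fun s _ => hd1 s)
      (by fun_prop) (continuous_speed_integrand hc hγ)
    have e0 : η (2 * 0) = 0 := ηneg _ (by norm_num)
    have e1 : η (2 * (1 / 2)) = 1 := ηone _ (by norm_num)
    rw [e0, e1] at this
    rw [← this]
    refine intervalIntegral.integral_congr fun s hs => ?_
    rw [uIcc_of_le (by norm_num)] at hs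
    have z1 : η (2 * s - 1) = 0 := ηneg _ (by linarith [hs.2])
    have z2 : deriv η (2 * s - 1) = 0 := deriv_smoothTransition_of_nonpos (by linarith [hs.2])
    rw [hδd]
    simp only [hδ, z1, z2, Function.comp_apply, mul_zero, zero_smul, add_zero, norm_smul]
    rw [Real.norm_of_nonneg (mul_nonneg zero_le_two (hη0 _))]
    ring
  · have hint : ∫ s in (1 / 2 : ℝ)..1, 2 * deriv η (2 * s - 1) = 1 := by
      rw [intervalIntegral.integral_eq_sub_of_hasDerivAt (fun s _ => hd2 s)
        (Continuous.intervalIntegrable (by fun_prop) _ _),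
        ηone _ (by norm_num),
        ηneg _ (by norm_num)]
      norm_num
    have : C * ‖y - x‖ = ∫ s in (1 / 2 : ℝ)..1, (C * ‖y - x‖) * (2 * deriv η (2 * s - 1)) := by
      rw [intervalIntegral.integral_const_mul, hint, mul_one]
    rw [this]
    refine intervalIntegral.integral_mono_on (by norm_num) (hI.intervalIntegrable _ _)
      (Continuous.intervalIntegrable (by fun_prop) _ _) fun s hs => ?_
    have z1 : η (2 * s) = 1 := ηone _ (by linarith [hs.1])
    have z2 : deriv η (2 * s) = 0 := deriv_smoothTransition_of_one_le (by linarith [hs.1])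
    have hseg : δ s ∈ segment ℝ x y := by
      rw [segment_eq_image']
      exact ⟨η (2 * s - 1), ⟨Real.smoothTransition.nonneg _, Real.smoothTransition.le_one _⟩,
        by simp only [hδ, z1, h1]⟩
    have hnorm : ‖deriv δ s‖ = 2 * deriv η (2 * s - 1) * ‖y - x‖ := by
      rw [hδd, z2, mul_zero, zero_smul, zero_add, norm_smul,
        Real.norm_of_nonneg (mul_nonneg zero_le_two (hη0 _))]
    rw [hnorm]
    have := mul_le_mul_of_nonneg_right (h _ hseg)
      (mul_nonneg (mul_nonneg zero_le_two (hη0 (2 * s - 1))) (norm_nonneg (y - x)))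
    linarith

end LeastTime

/-! ### The eikonal equation and the least time near the source -/

section Eikonal

variable {E : Type*} [NormedAddCommGroup E] [NormedSpace ℝ E] {n : E → ℝ}

lemma abs_leastTime_sub_le (hn : ∀ x, 0 < n x) (hc : Continuous n) {x y : E} {r C : ℝ}
    (h : ∀ z, ‖z - x‖ ≤ r → n z ≤ C) (hy : ‖y - x‖ ≤ r) :
    |leastTime n y - leastTime n x| ≤ C * ‖y - x‖ := by
  have hseg : ∀ z ∈ segment ℝ x y, n z ≤ C := fun z hz => h z <| by
    have hr : 0 ≤ r := (norm_nonneg _).trans hy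
    have := (convex_closedBall x r).segment_subset (Metric.mem_closedBall_self hr)
      (mem_closedBall_iff_norm.2 hy) hz
    exact mem_closedBall_iff_norm.1 this
  have h1 := leastTime_le_add_segment hn hc hseg
  have h2 := leastTime_le_add_segment (x := y) (y := x) hn hc (C := C)
    fun z hz => hseg z (segment_symm ℝ x y ▸ hz)
  rw [norm_sub_rev] at h2
  exact abs_sub_le_iff.2 ⟨by linarith, by linarith⟩

lemma eventually_abs_leastTime_sub_le (hn : ∀ x, 0 < n x) (hc : Continuous n) (x : E) {C : ℝ}
    (hC : n x < C) :
    ∀ᶠ y in 𝓝 x, ‖leastTime n y - leastTime n x‖ ≤ C * ‖y - x‖ := by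
  obtain ⟨r, hr, hball⟩ := Metric.eventually_nhds_iff_ball.1
    (hc.continuousAt.eventually_lt (continuousAt_const (y := C)) hC)
  filter_upwards [Metric.ball_mem_nhds x (half_pos hr)] with y hy
  refine abs_leastTime_sub_le hn hc (r := r / 2) (fun z hz => (hball z ?_).le) ?_
  · rw [mem_ball_iff_norm]; linarith
  · exact (mem_ball_iff_norm.1 hy).le

lemma continuous_leastTime (hn : ∀ x, 0 < n x) (hc : Continuous n) :
    Continuous (leastTime n) := by
  refine continuous_iff_continuousAt.2 fun x => ?_
  rw [ContinuousAt, tendsto_iff_norm_sub_tendsto_zero]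
  have h0 : Tendsto (fun y => (n x + 1) * ‖y - x‖) (𝓝 x) (𝓝 0) := by
    have : Continuous fun y : E => (n x + 1) * ‖y - x‖ := by fun_prop
    simpa using this.tendsto x
  exact squeeze_zero' (Eventually.of_forall fun _ => norm_nonneg _)
    (eventually_abs_leastTime_sub_le hn hc x (lt_add_one _)) h0

variable [CompleteSpace E]

/-- The least time is bounded below by a positive constant away from the source. -/
lemma exists_pos_le_leastTime (hn : ∀ x, 0 < n x) (hc : Continuous n) {r : ℝ} (hr : 0 < r) :
    ∃ δ > 0, ∀ x, r ≤ ‖x‖ → δ ≤ leastTime n x := by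
  obtain ⟨r', hr', hball⟩ := Metric.eventually_nhds_iff_ball.1
    ((continuousAt_const (y := n 0 / 2)).eventually_lt hc.continuousAt (half_lt_self (hn 0)))
  have hm : 0 < min (r' / 2) r := lt_min (half_pos hr') hr
  refine ⟨n 0 / 2 * min (r' / 2) r, mul_pos (half_pos (hn 0)) hm, fun x hx => ?_⟩
  refine mul_le_leastTime hn hc hm.le (half_pos (hn 0)).le (fun y hy => (hball y ?_).le)
    ((min_le_right _ _).trans hx)
  rw [mem_ball_zero_iff]
  linarith [min_le_left (r' / 2) r]

lemma leastTime_pos (hn : ∀ x, 0 < n x) (hc : Continuous n) {x : E} (hx : x ≠ 0) :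
    0 < leastTime n x := by
  obtain ⟨δ, hδ, h⟩ := exists_pos_le_leastTime hn hc (norm_pos_iff.2 hx)
  exact hδ.trans_le (h x le_rfl)

/-- The **eikonal equation** `|∇τ| = n` at every point of differentiability off the source. -/
lemma norm_eq_of_hasFDerivAt_leastTime (hn : ∀ x, 0 < n x) (hc : Continuous n) {x : E}
    (hx : x ≠ 0) {L : E →L[ℝ] ℝ} (hL : HasFDerivAt (leastTime n) L x) : ‖L‖ = n x := by
  refine le_antisymm (le_of_forall_pos_le_add fun ε hε => ?_)
    (le_of_forall_pos_le_add fun ε hε => ?_)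
  · exact hL.le_of_lip' (by linarith [hn x])
      (eventually_abs_leastTime_sub_le hn hc x (lt_add_of_pos_right _ hε))
  · obtain ⟨r₁, hr₁, h₁⟩ := Metric.eventually_nhds_iff_ball.1
      ((continuousAt_const (y := n x - ε / 2)).eventually_lt hc.continuousAt
        (sub_lt_self (n x) (half_pos hε)))
    obtain ⟨r₂, hr₂, h₂⟩ := Metric.eventually_nhds_iff_ball.1
      (hL.isLittleO.def (half_pos hε))
    -- near `x`, `n` exceeds `n x - ε / 2` and `τ` is at least `τ x - (‖L‖ + ε / 2) r` on the sphere
    set r := min (min (r₁ / 2) (r₂ / 2)) ‖x‖ with hr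
    have hr0 : 0 < r := lt_min (lt_min (half_pos hr₁) (half_pos hr₂)) (norm_pos_iff.2 hx)
    have hr1 : r < r₁ := ((min_le_left _ _).trans (min_le_left _ _)).trans_lt (half_lt_self hr₁)
    have hr2 : r < r₂ := ((min_le_left _ _).trans (min_le_right _ _)).trans_lt (half_lt_self hr₂)
    have key := add_mul_le_leastTime hn hc (c := max (n x - ε / 2) 0)
      (A := leastTime n x - (‖L‖ + ε / 2) * r) hr0.le (min_le_right _ _) (le_max_right _ _)
      (fun y hy => max_le (h₁ y (mem_ball_iff_norm.2 (hy.trans_lt hr1))).le (hn y).le)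
      (fun y hy => by
        have e1 := h₂ y (mem_ball_iff_norm.2 (hy.trans_lt hr2))
        rw [hy, Real.norm_eq_abs] at e1
        have e2 := L.le_opNorm (y - x)
        rw [hy, Real.norm_eq_abs] at e2
        linarith [neg_abs_le (leastTime n y - leastTime n x - L (y - x)), neg_abs_le (L (y - x))])
    have h3 : max (n x - ε / 2) 0 * r ≤ (‖L‖ + ε / 2) * r := by linarith
    linarith [le_of_mul_le_mul_right h3 hr0, le_max_left (n x - ε / 2) 0]

/-- The eikonal equation for the squared least time; the source is no longer exceptional. -/
lemma norm_fderiv_leastTime_sq (hn : ∀ x, 0 < n x) (hc : Continuous n) {x : E}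
    (hq : DifferentiableAt ℝ (fun x => leastTime n x ^ 2) x) :
    ‖fderiv ℝ (fun x => leastTime n x ^ 2) x‖ ^ 2 = 4 * n x ^ 2 * leastTime n x ^ 2 := by
  rcases eq_or_ne x 0 with rfl | hx
  · have : IsLocalMin (fun x => leastTime n x ^ 2) 0 := Eventually.of_forall fun y => by
      simpa [leastTime_zero hn] using sq_nonneg (leastTime n y)
    rw [this.fderiv_eq_zero, leastTime_zero hn]
    simp
  · have hpos := leastTime_pos hn hc hx
    have hτ : leastTime n = fun x => Real.sqrt (leastTime n x ^ 2) :=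
      funext fun y => (Real.sqrt_sq (leastTime_nonneg hn y)).symm
    have hd : DifferentiableAt ℝ (leastTime n) x := by
      rw [hτ]; exact hq.sqrt (pow_pos hpos 2).ne'
    have h1 := norm_eq_of_hasFDerivAt_leastTime hn hc hx hd.hasFDerivAt
    rw [(hd.hasFDerivAt.pow 2).fderiv, norm_smul, h1]
    simp only [Nat.add_one_sub_one, pow_one, nsmul_eq_mul, Nat.cast_ofNat, norm_mul,
      Real.norm_ofNat, Real.norm_of_nonneg hpos.le]
    ring

/-- Near the source the squared least time is that of a homogeneous medium, to leading order. -/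
lemma exists_abs_leastTime_sq_sub_le (hn : ∀ x, 0 < n x) (hc : Continuous n)
    (hd : DifferentiableAt ℝ n 0) :
    ∃ C r : ℝ, 0 < r ∧ ∀ x, ‖x‖ ≤ r →
      |leastTime n x ^ 2 - n 0 ^ 2 * ‖x‖ ^ 2| ≤ C * ‖x‖ ^ 3 := by
  obtain ⟨C, hC0, hC⟩ := hd.isBigO_sub.exists_pos
  obtain ⟨r', hr', hball⟩ := Metric.eventually_nhds_iff_ball.1 hC.bound
  have hn1 : ∀ y, ‖y‖ ≤ r' / 2 → |n y - n 0| ≤ C * ‖y‖ := fun y hy => by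
    simpa using hball y (mem_ball_zero_iff.2 (by linarith))
  refine ⟨C * (2 * n 0 + C * (r' / 2)), r' / 2, half_pos hr', fun x hx => ?_⟩
  have hx0 := norm_nonneg x
  have hn0 := hn 0
  have hup : leastTime n x ≤ (n 0 + C * ‖x‖) * ‖x‖ := by
    have := abs_leastTime_sub_le hn hc (x := 0) (y := x) (r := ‖x‖) (C := n 0 + C * ‖x‖)
      (fun z hz => by
        rw [sub_zero] at hz
        have := (abs_le.1 (hn1 z (hz.trans hx))).2
        nlinarith [mul_le_mul_of_nonneg_left hz hC0.le]) (by simp)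
    rw [leastTime_zero hn, sub_zero, sub_zero] at this
    exact (le_abs_self _).trans this
  have hlow : (n 0 - C * ‖x‖) * ‖x‖ ≤ leastTime n x := by
    have := mul_le_leastTime hn hc (r := ‖x‖) (c := max (n 0 - C * ‖x‖) 0) hx0 (le_max_right _ _)
      (fun z hz => max_le (by
        have := (abs_le.1 (hn1 z (hz.trans hx))).1
        nlinarith [mul_le_mul_of_nonneg_left hz hC0.le]) (hn z).le) (x := x) le_rfl
    exact (mul_le_mul_of_nonneg_right (le_max_left _ _) hx0).trans this
  -- `τ² - n₀²|x|²` is the product of `τ - n₀|x|` and `τ + n₀|x|`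
  have habs : |leastTime n x - n 0 * ‖x‖| ≤ C * ‖x‖ ^ 2 := abs_le.2 ⟨by linarith, by linarith⟩
  have hτ := leastTime_nonneg hn x
  have hsum : |leastTime n x + n 0 * ‖x‖| ≤ (2 * n 0 + C * (r' / 2)) * ‖x‖ := by
    rw [abs_of_nonneg (by positivity)]
    have : C * ‖x‖ * ‖x‖ ≤ C * (r' / 2) * ‖x‖ :=
      mul_le_mul_of_nonneg_right (mul_le_mul_of_nonneg_left hx hC0.le) hx0
    linarith
  have hfac : leastTime n x ^ 2 - n 0 ^ 2 * ‖x‖ ^ 2 =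
    (leastTime n x - n 0 * ‖x‖) * (leastTime n x + n 0 * ‖x‖) := by ring
  rw [hfac, abs_mul]
  refine (mul_le_mul habs hsum (abs_nonneg _) (by positivity)).trans_eq (by ring)

end Eikonal

/-! ### Squared phases and the divergence theorem -/

/-- A squared traveltime `q`, smooth on `{q < T²}`, together with a smooth vector field `W` there
along which `q` is homogeneous of degree two, `W · ∇q = 2 q`, and such that `q` behaves like
`n₀² |x|²` at the source and is bounded below away from it. -/
structure SquaredPhase (E : Type*) [NormedAddCommGroup E] [InnerProductSpace ℝ E] where
  /-- the squared traveltime -/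
  q : E → ℝ
  /-- the Euler field of `q` -/
  W : E → E
  /-- the time before which `q` is smooth -/
  T : ℝ
  /-- the slowness at the source -/
  n₀ : ℝ
  T_pos : 0 < T
  n₀_pos : 0 < n₀
  q_nonneg : ∀ x, 0 ≤ q x
  continuous_q : Continuous q
  contDiffOn_q : ContDiffOn ℝ ∞ q {x | q x < T ^ 2}
  contDiffOn_W : ContDiffOn ℝ ∞ W {x | q x < T ^ 2}
  fderiv_q_W : ∀ x, q x < T ^ 2 → fderiv ℝ q x (W x) = 2 * q x
  near_source : ∃ C r : ℝ, 0 < r ∧ ∀ x, ‖x‖ ≤ r → |q x - n₀ ^ 2 * ‖x‖ ^ 2| ≤ C * ‖x‖ ^ 3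
  off_source : ∀ r > 0, ∃ δ > 0, ∀ x, r ≤ ‖x‖ → δ ≤ q x

/-- `∫ ∂ᵥX = 0` for `X` of class `C¹` with compact support. -/
lemma integral_fderiv_apply_eq_zero {E : Type*} [NormedAddCommGroup E] [NormedSpace ℝ E]
    [FiniteDimensional ℝ E] [MeasurableSpace E] [BorelSpace E] {μ : Measure E}
    [μ.IsAddHaarMeasure] {X : E → ℂ} (hX : ContDiff ℝ 1 X) (hs : HasCompactSupport X) (v : E) :
    Integrable (fun x => fderiv ℝ X x v) μ ∧ ∫ x, fderiv ℝ X x v ∂μ = 0 := by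
  have hi : Integrable (fun x => fderiv ℝ X x v) μ :=
    ((hX.continuous_fderiv one_ne_zero).clm_apply continuous_const).integrable_of_hasCompactSupport
      (hs.fderiv_apply ℝ v)
  refine ⟨hi, ?_⟩
  have := integral_mul_fderiv_eq_neg_fderiv_mul_of_integrable (μ := μ) (f := fun _ : E => (1 : ℂ))
    (g := X) (v := v) (by simp) (by simpa using hi)
    (by simpa using hX.continuous.integrable_of_hasCompactSupport hs)
    (fun _ _ => differentiableAt_const _) (fun x _ => hX.differentiable one_ne_zero x)
  simpa using this

namespace SquaredPhase

variable {E : Type*} [NormedAddCommGroup E] [InnerProductSpace ℝ E] (P : SquaredPhase E)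

/-- The caustic-free neighbourhood of the source. -/
def U : Set E := {x | P.q x < P.T ^ 2}

lemma isOpen_U : IsOpen P.U := isOpen_lt P.continuous_q continuous_const

/-- An amplitude: smooth on the caustic-free neighbourhood and zero far away. Its values at
bounded distance outside the neighbourhood are arbitrary; they meet a vanishing factor. -/
def IsAmplitude (ψ : E → ℝ) : Prop :=
  ContDiffOn ℝ ∞ ψ P.U ∧ ∃ R : ℝ, ∀ x, R < ‖x‖ → ψ x = 0

variable {P}

/-- A function of `t² - q` vanishing for `q ≥ t²`, times a function smooth before `T`, is smooth on
the whole space if `t < T`. -/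
lemma contDiff_comp_mul {k : WithTop ℕ∞} (hk : k ≤ ∞) {h : ℝ → ℂ} (hh : ContDiff ℝ k h)
    (h0 : ∀ s ≤ 0, h s = 0) {g : E → ℝ} (hg : ContDiffOn ℝ k g P.U) {t : ℝ}
    (ht : t ^ 2 < P.T ^ 2) : ContDiff ℝ k fun x => h (t ^ 2 - P.q x) * (g x : ℂ) := by
  refine contDiff_iff_contDiffAt.2 fun x => ?_
  rcases lt_or_ge (P.q x) (P.T ^ 2) with hx | hx
  · have hU : P.U ∈ 𝓝 x := P.isOpen_U.mem_nhds hx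
    have h1 : ContDiffAt ℝ k P.q x := (P.contDiffOn_q.of_le hk).contDiffAt hU
    have h2 : ContDiffAt ℝ k (fun x => h (t ^ 2 - P.q x)) x :=
      hh.contDiffAt.comp x (contDiffAt_const.sub h1)
    have h3 : ContDiffAt ℝ k (fun x => (g x : ℂ)) x :=
      Complex.ofRealCLM.contDiff.contDiffAt.comp x (hg.contDiffAt hU)
    exact h2.mul h3
  · have : (fun x => h (t ^ 2 - P.q x) * (g x : ℂ)) =ᶠ[𝓝 x] fun _ => 0 := by
      filter_upwards [P.continuous_q.continuousAt.eventually (lt_mem_nhds (ht.trans_le hx))]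
        with y hy
      rw [h0 _ (by linarith), zero_mul]
    exact contDiffAt_const.congr_of_eventuallyEq this

lemma hasCompactSupport_mul [FiniteDimensional ℝ E] {g : E → ℝ} {R : ℝ}
    (hR : ∀ x, R < ‖x‖ → g x = 0) (f : E → ℂ) : HasCompactSupport fun x => f x * (g x : ℂ) := by
  refine HasCompactSupport.of_support_subset_isCompact (isCompact_closedBall (0 : E) R)
    fun x hx => ?_
  rw [mem_closedBall_zero_iff]
  by_contra hcon
  exact hx (by simp [hR x (not_le.1 hcon)])

lemma integrable_comp_mul [FiniteDimensional ℝ E] [MeasurableSpace E] [BorelSpace E]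
    {h : ℝ → ℂ} (hh : Continuous h) (h0 : ∀ s ≤ 0, h s = 0) {g : E → ℝ}
    (hg : ContinuousOn g P.U) {R : ℝ} (hR : ∀ x, R < ‖x‖ → g x = 0)
    {t : ℝ} (ht : t ^ 2 < P.T ^ 2) : Integrable fun x => h (t ^ 2 - P.q x) * (g x : ℂ) :=
  (contDiff_comp_mul (k := 0) (by simp) (contDiff_zero.2 hh) h0
    (contDiffOn_zero.2 hg) ht).continuous.integrable_of_hasCompactSupport
      (hasCompactSupport_mul hR _)

lemma IsAmplitude.contDiffOn_component {ψ : E → ℝ} (hψ : P.IsAmplitude ψ) (v : E) :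
    ContDiffOn ℝ ∞ (fun y => ψ y * inner ℝ v (P.W y)) P.U :=
  hψ.1.mul (contDiffOn_const.inner ℝ P.contDiffOn_W)

variable [FiniteDimensional ℝ E]

variable (P) in
/-- The operator `ψ ↦ ½ ∇ · (ψ W)`. -/
noncomputable def dilation (ψ : E → ℝ) (x : E) : ℝ :=
  1 / 2 * ∑ i, fderiv ℝ (fun y => ψ y * inner ℝ (stdOrthonormalBasis ℝ E i) (P.W y)) x
    (stdOrthonormalBasis ℝ E i)

lemma IsAmplitude.dilation {ψ : E → ℝ} (hψ : P.IsAmplitude ψ) :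
    P.IsAmplitude (P.dilation ψ) := by
  refine ⟨contDiffOn_const.mul (ContDiffOn.sum fun i _ => ?_), ?_⟩
  · exact ((hψ.contDiffOn_component _).fderiv_of_isOpen P.isOpen_U (by simp)).clm_apply
      contDiffOn_const
  · obtain ⟨R, hR⟩ := hψ.2
    refine ⟨R, fun x hx => ?_⟩
    have hz : ∀ v : E, fderiv ℝ (fun y => ψ y * inner ℝ v (P.W y)) x = 0 := fun v => by
      have : (fun y => ψ y * inner ℝ v (P.W y)) =ᶠ[𝓝 x] fun _ => (0 : ℝ) := by
        filter_upwards [(isOpen_lt continuous_const continuous_norm).mem_nhds hx] with y hy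
        rw [hR y hy, zero_mul]
      rw [this.fderiv_eq]; simp
    simp [SquaredPhase.dilation, hz]

variable [MeasurableSpace E] [BorelSpace E]

/-- The divergence theorem for the vector field `h(t² - q) ψ W`. -/
lemma integral_deriv_comp_mul {h : ℝ → ℂ} (hh : ContDiff ℝ 1 h) (h0 : ∀ s ≤ 0, h s = 0)
    {ψ : E → ℝ} (hψ : P.IsAmplitude ψ) {t : ℝ} (ht : t ^ 2 < P.T ^ 2) :
    ∫ x, deriv h (t ^ 2 - P.q x) * ((P.q x * ψ x : ℝ) : ℂ) =
      ∫ x, h (t ^ 2 - P.q x) * (P.dilation ψ x : ℂ) := by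
  set b := stdOrthonormalBasis ℝ E
  set X : Fin (Module.finrank ℝ E) → E → ℂ := fun i x =>
    h (t ^ 2 - P.q x) * ((ψ x * inner ℝ (b i) (P.W x) : ℝ) : ℂ) with hX
  obtain ⟨R, hR⟩ := hψ.2
  have hXi : ∀ i, Integrable (fun x => fderiv ℝ (X i) x (b i)) ∧
      ∫ x, fderiv ℝ (X i) x (b i) = 0 := fun i =>
    integral_fderiv_apply_eq_zero
      (contDiff_comp_mul (by exact_mod_cast le_top) hh h0
        ((hψ.contDiffOn_component (b i)).of_le (by exact_mod_cast le_top)) ht)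
      (hasCompactSupport_mul (R := R) (fun x hx => by simp [hR x hx]) _) _
  have hdh0 : ∀ s ≤ 0, deriv h s = 0 := by
    have hneg : ∀ s < 0, deriv h s = 0 := fun s hs => by
      have : h =ᶠ[𝓝 s] fun _ => (0 : ℂ) := by
        filter_upwards [Iio_mem_nhds hs] with u hu using h0 u (le_of_lt hu)
      rw [this.deriv_eq]; simp
    intro s hs
    rcases hs.lt_or_eq with hs | rfl
    · exact hneg s hs
    · have hc := (hh.continuous_deriv le_rfl).continuousAt (x := (0 : ℝ))
      refine tendsto_nhds_unique (hc.mono_left (nhdsWithin_le_nhds (s := Iio 0))) ?_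
      refine tendsto_const_nhds.congr' ?_
      filter_upwards [self_mem_nhdsWithin] with u hu using (hneg u hu).symm
  -- `∇ · (h(t² - q) ψ W) = 2 h(t² - q) D ψ - 2 h'(t² - q) q ψ`, because `W · ∇q = 2 q`
  have hpt : ∀ x, ∑ i, fderiv ℝ (X i) x (b i) =
      2 * (h (t ^ 2 - P.q x) * (P.dilation ψ x : ℂ)) -
        2 * (deriv h (t ^ 2 - P.q x) * ((P.q x * ψ x : ℝ) : ℂ)) := fun x => by
    rcases lt_or_ge (P.q x) (P.T ^ 2) with hx | hx
    · have hU : P.U ∈ 𝓝 x := P.isOpen_U.mem_nhds hx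
      have hq : HasFDerivAt P.q (fderiv ℝ P.q x) x :=
        ((P.contDiffOn_q.contDiffAt hU).differentiableAt (by simp)).hasFDerivAt
      have hc : HasFDerivAt (fun x => h (t ^ 2 - P.q x))
          ((-fderiv ℝ P.q x).smulRight (deriv h (t ^ 2 - P.q x))) x := by
        have h1 := (hh.differentiable one_ne_zero (t ^ 2 - P.q x)).hasDerivAt
        have := h1.hasFDerivAt.comp x (hq.const_sub (t ^ 2))
        convert! this using 1
      have hi : ∀ i, fderiv ℝ (X i) x (b i) =
          h (t ^ 2 - P.q x) *
            ((fderiv ℝ (fun y => ψ y * inner ℝ (b i) (P.W y)) x (b i) : ℝ) : ℂ) -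
          deriv h (t ^ 2 - P.q x) * ψ x *
            ((inner ℝ (b i) (P.W x) * fderiv ℝ P.q x (b i) : ℝ) : ℂ) := fun i => by
        have hg : HasFDerivAt (fun y => ψ y * inner ℝ (b i) (P.W y))
            (fderiv ℝ (fun y => ψ y * inner ℝ (b i) (P.W y)) x) x :=
          (((hψ.contDiffOn_component (b i)).contDiffAt hU).differentiableAt (by simp)).hasFDerivAt
        have hg' := Complex.ofRealCLM.hasFDerivAt.comp x hg
        have := (hc.mul hg').fderiv
        simp only [hX]
        erw [this]
        simp
        ring
      have hsum : ∑ i, inner ℝ (b i) (P.W x) * fderiv ℝ P.q x (b i) = 2 * P.q x := by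
        rw [← P.fderiv_q_W x hx]
        conv_rhs => rw [← b.sum_repr' (P.W x)]
        simp [map_sum]
      simp_rw [hi]
      rw [Finset.sum_sub_distrib, ← Finset.mul_sum, ← Finset.mul_sum, ← Complex.ofReal_sum,
        ← Complex.ofReal_sum, hsum, SquaredPhase.dilation]
      push_cast
      ring
    · have hz : ∀ i, fderiv ℝ (X i) x = 0 := fun i => by
        have : X i =ᶠ[𝓝 x] fun _ => 0 := by
          filter_upwards [P.continuous_q.continuousAt.eventually (lt_mem_nhds (ht.trans_le hx))]
            with y hy
          simp only [hX]
          rw [h0 _ (by linarith), zero_mul]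
        rw [this.fderiv_eq]; simp
      simp [hz, h0 (t ^ 2 - P.q x) (by linarith), hdh0 (t ^ 2 - P.q x) (by linarith)]
  have hI1 : Integrable fun x => h (t ^ 2 - P.q x) * (P.dilation ψ x : ℂ) := by
    obtain ⟨R', hR'⟩ := hψ.dilation.2
    exact integrable_comp_mul hh.continuous h0 hψ.dilation.1.continuousOn hR' ht
  have hI2 : Integrable fun x => deriv h (t ^ 2 - P.q x) * ((P.q x * ψ x : ℝ) : ℂ) :=
    integrable_comp_mul (hh.continuous_deriv le_rfl) hdh0
      (P.continuous_q.continuousOn.mul hψ.1.continuousOn) (R := R)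
      (fun x hx => by simp [hR x hx]) ht
  have htot : ∫ x, ∑ i, fderiv ℝ (X i) x (b i) = 0 := by
    rw [integral_finsetSum _ fun i _ => (hXi i).1]
    exact Finset.sum_eq_zero fun i _ => (hXi i).2
  simp_rw [hpt] at htot
  rw [integral_sub (hI1.const_mul 2) (hI2.const_mul 2), integral_const_mul, integral_const_mul,
    ← mul_sub, mul_eq_zero, sub_eq_zero] at htot
  exact (htot.resolve_left two_ne_zero).symm

end SquaredPhase

/-! ### Truncated powers and their regularization -/

/-- The truncated power `s₊^w`. -/
noncomputable def posPow (w : ℂ) (s : ℝ) : ℂ := if 0 < s then (s : ℂ) ^ w else 0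

lemma posPow_of_pos {s : ℝ} (hs : 0 < s) (w : ℂ) : posPow w s = (s : ℂ) ^ w := if_pos hs

lemma posPow_of_nonpos {s : ℝ} (hs : s ≤ 0) (w : ℂ) : posPow w s = 0 := if_neg (not_lt.2 hs)

lemma norm_posPow {s : ℝ} (hs : 0 < s) (w : ℂ) : ‖posPow w s‖ = s ^ w.re := by
  rw [posPow_of_pos hs, Complex.norm_cpow_eq_rpow_re_of_pos hs]

lemma posPow_add_one (w : ℂ) (s : ℝ) : posPow (w + 1) s = s * posPow w s := by
  rcases le_or_gt s 0 with hs | hs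
  · simp [posPow_of_nonpos hs]
  · rw [posPow_of_pos hs, posPow_of_pos hs,
      Complex.cpow_add _ _ (Complex.ofReal_ne_zero.2 hs.ne'), Complex.cpow_one, mul_comm]

lemma continuous_posPow {w : ℂ} (hw : 0 < w.re) : Continuous (posPow w) := by
  have h : posPow w = fun s => ((max s 0 : ℝ) : ℂ) ^ w := by
    ext s
    rcases le_or_gt s 0 with hs | hs
    · have : w ≠ 0 := fun h => by simp [h] at hw
      simp [posPow_of_nonpos hs, max_eq_right hs, this]
    · rw [posPow_of_pos hs, max_eq_left hs.le]
  rw [h]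
  exact (Complex.continuous_ofReal_cpow_const hw).comp (by fun_prop)

lemma measurable_posPow (w : ℂ) : Measurable (posPow w) :=
  Measurable.ite measurableSet_Ioi (Complex.measurable_ofReal.pow_const w) measurable_const

lemma hasDerivAt_posPow {w : ℂ} (hw : 1 < w.re) (s : ℝ) :
    HasDerivAt (posPow w) (w * posPow (w - 1) s) s := by
  have hne : ∀ y ≠ (0 : ℝ), HasDerivAt (posPow w) (w * posPow (w - 1) y) y := by
    intro y hy
    rcases hy.lt_or_gt with hy | hy
    · rw [posPow_of_nonpos hy.le, mul_zero]
      refine (hasDerivAt_const y (0 : ℂ)).congr_of_eventuallyEq ?_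
      filter_upwards [Iio_mem_nhds hy] with u hu using posPow_of_nonpos (le_of_lt hu) w
    · have hw0 : w ≠ 0 := fun h => by simp [h] at hw; linarith
      rw [posPow_of_pos hy]
      refine (hasDerivAt_ofReal_cpow_const hy.ne' hw0).congr_of_eventuallyEq ?_
      filter_upwards [Ioi_mem_nhds hy] with u hu using posPow_of_pos hu w
  rcases eq_or_ne s 0 with rfl | hs
  · exact hasDerivAt_of_hasDerivAt_of_ne hne
      (continuous_posPow (by linarith)).continuousAt
      (continuous_const.mul (continuous_posPow (by simpa using hw))).continuousAt
  · exact hne s hs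

lemma gsFun_eq (z : ℂ) (s : ℝ) : gsFun z s = posPow z s / Complex.Gamma (z + 1) := by
  unfold gsFun posPow
  split_ifs <;> simp

lemma gsFun_of_nonpos {s : ℝ} (hs : s ≤ 0) (z : ℂ) : gsFun z s = 0 := if_neg (not_lt.2 hs)

lemma continuous_gsFun {z : ℂ} (hz : 0 < z.re) : Continuous (gsFun z) := by
  have : gsFun z = fun s => posPow z s / Complex.Gamma (z + 1) := funext (gsFun_eq z)
  rw [this]
  exact (continuous_posPow hz).div_const _

lemma hasDerivAt_gsFun_add_one {z : ℂ} (hz : 0 < z.re) (s : ℝ) :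
    HasDerivAt (gsFun (z + 1)) (gsFun z s) s := by
  have hz1 : z + 1 ≠ 0 := fun h => by
    have := congrArg Complex.re h
    simp at this; linarith
  have h := (hasDerivAt_posPow (w := z + 1) (by simpa using hz) s).div_const
    (Complex.Gamma (z + 1 + 1))
  have : gsFun (z + 1) = fun s => posPow (z + 1) s / Complex.Gamma (z + 1 + 1) :=
    funext (gsFun_eq _)
  rw [this, gsFun_eq]
  convert! h using 1
  rw [Complex.Gamma_add_one _ hz1, add_sub_cancel_right, mul_div_mul_left _ _ hz1]

/-- A `C¹` regularization of `s₊^(z+1)`, whose derivative is dominated by `s₊^z` uniformly in `ε`.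
The two additional powers in the numerator make it `C¹` for all `Re z > -1`. -/
noncomputable def regPow (ε : ℝ) (z : ℂ) (s : ℝ) : ℂ := posPow (z + 3) s / ((s ^ 2 + ε : ℝ) : ℂ)

/-- The derivative of `regPow`. -/
noncomputable def regPowDeriv (ε : ℝ) (z : ℂ) (s : ℝ) : ℂ :=
  posPow (z + 2) s * (((z + 1) * s ^ 2 + (z + 3) * ε) / ((s ^ 2 + ε : ℝ) : ℂ) ^ 2)

section

variable {ε : ℝ} {z : ℂ}

lemma posPow_add_two (w : ℂ) (s : ℝ) : posPow (w + 2) s = s ^ 2 * posPow w s := by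
  rw [show w + 2 = w + 1 + 1 by ring, posPow_add_one, posPow_add_one]; ring

lemma hasDerivAt_regPow (hε : 0 < ε) (hz : -1 < z.re) (s : ℝ) :
    HasDerivAt (regPow ε z) (regPowDeriv ε z s) s := by
  have hne : ((s ^ 2 + ε : ℝ) : ℂ) ≠ 0 := Complex.ofReal_ne_zero.2 (by positivity)
  have h1 := hasDerivAt_posPow (w := z + 3) (by simp; linarith) s
  have h2 : HasDerivAt (fun s : ℝ => ((s ^ 2 + ε : ℝ) : ℂ)) ((2 * s : ℝ) : ℂ) s := by
    have := ((hasDerivAt_pow 2 s).add_const ε).ofReal_comp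
    simpa using this
  refine (h1.div h2 hne).congr_deriv ?_
  have e1 : z + 3 - 1 = z + 2 := by ring
  have e2 : posPow (z + 3) s = s * posPow (z + 2) s := by
    rw [← posPow_add_one]; congr 1; ring
  rw [regPowDeriv, e1, e2, mul_div_assoc', div_left_inj' (pow_ne_zero 2 hne)]
  push_cast
  ring

lemma continuous_regPowDeriv (hε : 0 < ε) (hz : -1 < z.re) : Continuous (regPowDeriv ε z) := by
  refine (continuous_posPow (by simp; linarith)).mul (Continuous.div (by fun_prop) (by fun_prop)
    fun s => pow_ne_zero 2 (Complex.ofReal_ne_zero.2 (by positivity)))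

lemma contDiff_regPow (hε : 0 < ε) (hz : -1 < z.re) : ContDiff ℝ 1 (regPow ε z) := by
  have hd : deriv (regPow ε z) = regPowDeriv ε z :=
    funext fun s => (hasDerivAt_regPow hε hz s).deriv
  exact contDiff_one_iff_deriv.2 ⟨fun s => (hasDerivAt_regPow hε hz s).differentiableAt,
    hd ▸ continuous_regPowDeriv hε hz⟩

lemma norm_regPow_le (hε : 0 < ε) (s : ℝ) : ‖regPow ε z s‖ ≤ ‖posPow (z + 1) s‖ := by
  have hp : 0 < s ^ 2 + ε := by positivity
  rw [regPow, show z + 3 = z + 1 + 2 by ring, posPow_add_two, norm_div, norm_mul,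
    Complex.norm_of_nonneg hp.le, div_le_iff₀ hp, mul_comm]
  refine mul_le_mul_of_nonneg_left ?_ (norm_nonneg _)
  rw [norm_pow, Complex.norm_real, Real.norm_eq_abs, sq_abs]
  linarith

lemma norm_regPowDeriv_le (hε : 0 < ε) (s : ℝ) :
    ‖regPowDeriv ε z s‖ ≤ (‖z‖ + 3) * ‖posPow z s‖ := by
  have hp : 0 < s ^ 2 + ε := by positivity
  have hs2 : ‖(s : ℂ) ^ 2‖ = s ^ 2 := by
    rw [norm_pow, Complex.norm_real, Real.norm_eq_abs, sq_abs]
  have h1 : ‖(z + 1) * (s : ℂ) ^ 2 + (z + 3) * ε‖ ≤ (‖z‖ + 3) * (s ^ 2 + ε) := by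
    refine (norm_add_le _ _).trans ?_
    rw [norm_mul, norm_mul, hs2, Complex.norm_of_nonneg hε.le]
    have a1 : ‖z + 1‖ ≤ ‖z‖ + 3 := (norm_add_le _ _).trans (by simp)
    have a2 : ‖z + 3‖ ≤ ‖z‖ + 3 := (norm_add_le _ _).trans (by simp)
    nlinarith [mul_le_mul_of_nonneg_right a1 (sq_nonneg s), mul_le_mul_of_nonneg_right a2 hε.le]
  rw [regPowDeriv, posPow_add_two, norm_mul, norm_mul, norm_div, hs2, norm_pow,
    Complex.norm_of_nonneg hp.le]
  have h2 : s ^ 2 * (‖(z + 1) * (s : ℂ) ^ 2 + (z + 3) * ε‖ / (s ^ 2 + ε) ^ 2) ≤ ‖z‖ + 3 := by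
    rw [mul_div_assoc', div_le_iff₀ (by positivity)]
    calc s ^ 2 * ‖(z + 1) * (s : ℂ) ^ 2 + (z + 3) * ε‖
        ≤ (s ^ 2 + ε) * ((‖z‖ + 3) * (s ^ 2 + ε)) :=
          mul_le_mul (by linarith) h1 (norm_nonneg _) hp.le
      _ = (‖z‖ + 3) * (s ^ 2 + ε) ^ 2 := by ring
  calc s ^ 2 * ‖posPow z s‖ * (‖(z + 1) * (s : ℂ) ^ 2 + (z + 3) * ε‖ / (s ^ 2 + ε) ^ 2)
      = s ^ 2 * (‖(z + 1) * (s : ℂ) ^ 2 + (z + 3) * ε‖ / (s ^ 2 + ε) ^ 2) * ‖posPow z s‖ := by ring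
    _ ≤ _ := mul_le_mul_of_nonneg_right h2 (norm_nonneg _)

lemma regPow_of_nonpos {s : ℝ} (hs : s ≤ 0) : regPow ε z s = 0 := by
  simp [regPow, posPow_of_nonpos hs]

lemma tendsto_ofReal_sq_add (s : ℝ) :
    Tendsto (fun ε : ℝ => ((s ^ 2 + ε : ℝ) : ℂ)) (𝓝[>] 0) (𝓝 ((s : ℂ) ^ 2)) := by
  have h : Continuous fun ε : ℝ => ((s ^ 2 + ε : ℝ) : ℂ) := by fun_prop
  simpa using (h.tendsto 0).mono_left nhdsWithin_le_nhds

lemma tendsto_regPow (z : ℂ) (s : ℝ) :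
    Tendsto (fun ε => regPow ε z s) (𝓝[>] 0) (𝓝 (posPow (z + 1) s)) := by
  rcases le_or_gt s 0 with hs | hs
  · simp [regPow_of_nonpos hs, posPow_of_nonpos hs]
  · have hs2 : (s : ℂ) ^ 2 ≠ 0 := pow_ne_zero 2 (Complex.ofReal_ne_zero.2 hs.ne')
    have := (tendsto_const_nhds (x := posPow (z + 3) s)).div (tendsto_ofReal_sq_add s) hs2
    rwa [show z + 3 = z + 1 + 2 by ring, posPow_add_two, mul_div_cancel_left₀ _ hs2,
      ← posPow_add_two, show z + 1 + 2 = z + 3 by ring] at this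

lemma tendsto_regPowDeriv (z : ℂ) (s : ℝ) :
    Tendsto (fun ε => regPowDeriv ε z s) (𝓝[>] 0) (𝓝 ((z + 1) * posPow z s)) := by
  rcases le_or_gt s 0 with hs | hs
  · simp [regPowDeriv, posPow_of_nonpos hs]
  · have hs2 : (s : ℂ) ^ 2 ≠ 0 := pow_ne_zero 2 (Complex.ofReal_ne_zero.2 hs.ne')
    have h1 : Tendsto (fun ε : ℝ => (z + 1) * (s : ℂ) ^ 2 + (z + 3) * ε) (𝓝[>] 0)
        (𝓝 ((z + 1) * (s : ℂ) ^ 2)) := by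
      have h : Continuous fun ε : ℝ => (z + 1) * (s : ℂ) ^ 2 + (z + 3) * ε := by fun_prop
      simpa using (h.tendsto 0).mono_left nhdsWithin_le_nhds
    have := (h1.div ((tendsto_ofReal_sq_add s).pow 2) (pow_ne_zero 2 hs2)).const_mul
      (posPow (z + 2) s)
    convert! this using 2
    rw [posPow_add_two]
    have hs1 : (s : ℂ) ≠ 0 := Complex.ofReal_ne_zero.2 hs.ne'
    field_simp

/-- For real exponents the derivative of the regularization is nonnegative. -/
lemma regPowDeriv_ofReal {σ : ℝ} (hσ : -1 < σ) (hε : 0 < ε) (s : ℝ) :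
    regPowDeriv ε σ s = ((‖regPowDeriv ε σ s‖ : ℝ) : ℂ) := by
  have : ∃ r : ℝ, 0 ≤ r ∧ regPowDeriv ε σ s = r := by
    rcases le_or_gt s 0 with hs | hs
    · exact ⟨0, le_rfl, by simp [regPowDeriv, posPow_of_nonpos hs]⟩
    · refine ⟨s ^ (σ + 2) * (((σ + 1) * s ^ 2 + (σ + 3) * ε) / (s ^ 2 + ε) ^ 2), ?_, ?_⟩
      · have h1 : 0 ≤ σ + 1 := by linarith
        have h3 : 0 ≤ σ + 3 := by linarith
        positivity
      · rw [regPowDeriv, posPow_of_pos hs]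
        push_cast
        rw [Complex.ofReal_cpow hs.le]
        push_cast
        rfl
  obtain ⟨r, hr, h⟩ := this
  rw [h, Complex.norm_of_nonneg hr]

end

/-! ### Absolute convergence and the recursion in the exponent -/

namespace SquaredPhase

variable {E : Type*} [NormedAddCommGroup E] [InnerProductSpace ℝ E] [FiniteDimensional ℝ E]
  {P : SquaredPhase E}

lemma exists_abs_le_of_q_le {g : E → ℝ} (hg : ContinuousOn g P.U) {R : ℝ}
    (hR : ∀ x, R < ‖x‖ → g x = 0) {t : ℝ} (ht : t ^ 2 < P.T ^ 2) :
    ∃ C, 0 ≤ C ∧ ∀ x, P.q x ≤ t ^ 2 → |g x| ≤ C := by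
  have hK : IsCompact (Metric.closedBall (0 : E) R ∩ {x | P.q x ≤ t ^ 2}) :=
    (isCompact_closedBall _ _).inter_right (isClosed_le P.continuous_q continuous_const)
  obtain ⟨C, hC⟩ := hK.exists_bound_of_continuousOn
    (hg.mono fun x hx => lt_of_le_of_lt (show P.q x ≤ t ^ 2 from hx.2) ht)
  refine ⟨max C 0, le_max_right _ _, fun x hx => ?_⟩
  rcases le_or_gt ‖x‖ R with h | h
  · exact (hC x ⟨mem_closedBall_zero_iff.2 h, hx⟩).trans (le_max_left _ _)
  · simp [hR x h]

/-- A compactly supported nonnegative amplitude equal to one on a given ball. -/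
lemma exists_cutoff (P : SquaredPhase E) (R : ℝ) :
    ∃ χ : E → ℝ, P.IsAmplitude χ ∧ Continuous χ ∧ HasCompactSupport χ ∧ (∀ x, 0 ≤ χ x) ∧
      ∀ x, ‖x‖ ≤ R → χ x = 1 := by
  let f : ContDiffBump (0 : E) := ⟨|R| + 1, |R| + 2, by positivity, by linarith⟩
  refine ⟨f, ⟨f.contDiff.contDiffOn, |R| + 2, fun x hx => ?_⟩, f.continuous, f.hasCompactSupport,
    fun x => f.nonneg, fun x hx => f.one_of_mem_closedBall ?_⟩
  · exact f.zero_of_le_dist (by simpa using hx.le)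
  · rw [mem_closedBall_zero_iff]
    exact hx.trans ((le_abs_self R).trans (by simp [f]))

variable [MeasurableSpace E] [BorelSpace E]

lemma aestronglyMeasurable_mul {h : ℝ → ℂ} (hh : Measurable h) (h0 : ∀ s ≤ 0, h s = 0)
    {g : E → ℝ} (hg : ContinuousOn g P.U) {t : ℝ} (ht : t ^ 2 < P.T ^ 2) :
    AEStronglyMeasurable (fun x => h (t ^ 2 - P.q x) * (g x : ℂ)) := by
  have hU : MeasurableSet P.U := P.isOpen_U.measurableSet
  have : (fun x => h (t ^ 2 - P.q x) * (g x : ℂ)) =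
      P.U.indicator fun x => h (t ^ 2 - P.q x) * (g x : ℂ) := by
    refine (indicator_eq_self.2 fun x hx => ?_).symm
    by_contra hcon
    refine hx ?_
    have : P.T ^ 2 ≤ P.q x := not_lt.1 hcon
    simp [h0 (t ^ 2 - P.q x) (by linarith)]
  rw [this, aestronglyMeasurable_indicator_iff hU]
  have hm : Measurable fun x => h (t ^ 2 - P.q x) :=
    hh.comp (measurable_const.sub P.continuous_q.measurable)
  exact hm.aestronglyMeasurable.mul
    ((Complex.continuous_ofReal.comp_continuousOn hg).aestronglyMeasurable hU)

/-- The singular power `(t² - q)₊^σ` with `σ > -1` is integrable against `q χ`: by the divergence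
theorem the integrals of its regularizations stay bounded. -/
lemma integrable_posPow_mul_q {σ : ℝ} (hσ : -1 < σ) {χ : E → ℝ} (hχ : P.IsAmplitude χ)
    (hχ0 : ∀ x, 0 ≤ χ x) {t : ℝ} (ht : t ^ 2 < P.T ^ 2) :
    Integrable fun x => posPow σ (t ^ 2 - P.q x) * ((P.q x * χ x : ℝ) : ℂ) := by
  have hσ' : -1 < (σ : ℂ).re := by simpa using hσ
  obtain ⟨R, hR⟩ := hχ.2
  have hqχ : ContinuousOn (fun x => P.q x * χ x) P.U :=
    P.continuous_q.continuousOn.mul hχ.1.continuousOn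
  have hqχR : ∀ x, R < ‖x‖ → P.q x * χ x = 0 := fun x hx => by simp [hR x hx]
  have hn0 : ∀ n : ℕ, (0 : ℝ) < 1 / ((n : ℝ) + 1) := fun n => by positivity
  have hlim : Tendsto (fun n : ℕ => 1 / ((n : ℝ) + 1)) atTop (𝓝[>] 0) :=
    tendsto_nhdsWithin_iff.2 ⟨tendsto_one_div_add_atTop_nhds_zero_nat,
      Eventually.of_forall fun n => hn0 n⟩
  set G : ℕ → E → ℂ := fun n x =>
    regPowDeriv (1 / ((n : ℝ) + 1)) σ (t ^ 2 - P.q x) * ((P.q x * χ x : ℝ) : ℂ) with hG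
  have hreg0 : ∀ n : ℕ, ∀ s ≤ 0, regPowDeriv (1 / ((n : ℝ) + 1)) σ s = 0 := fun n s hs => by
    simp [regPowDeriv, posPow_of_nonpos hs]
  have hGi : ∀ n, Integrable (G n) := fun n =>
    integrable_comp_mul (continuous_regPowDeriv (hn0 n) hσ') (hreg0 n) hqχ hqχR ht
  obtain ⟨R', hR'⟩ := hχ.dilation.2
  have hDi : Integrable fun x => posPow (σ + 1) (t ^ 2 - P.q x) * (P.dilation χ x : ℂ) :=
    integrable_comp_mul (continuous_posPow (by simp; linarith)) (fun s hs => posPow_of_nonpos hs _)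
      hχ.dilation.1.continuousOn hR' ht
  set M := ∫ x, ‖posPow (σ + 1) (t ^ 2 - P.q x) * (P.dilation χ x : ℂ)‖ with hM
  have hbound : ∀ n, ∫ x, ‖G n x‖ ≤ M := fun n => by
    have hGn : ∀ x, G n x = ((‖G n x‖ : ℝ) : ℂ) := fun x => by
      simp only [hG]
      rw [norm_mul, Complex.norm_of_nonneg (mul_nonneg (P.q_nonneg x) (hχ0 x))]
      conv_lhs => rw [regPowDeriv_ofReal hσ (hn0 n)]
      push_cast
      ring
    have h1 : ∫ x, G n x = ((∫ x, ‖G n x‖ : ℝ) : ℂ) := by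
      rw [← integral_complex_ofReal]
      exact integral_congr_ae (Eventually.of_forall hGn)
    have h2 : ∫ x, ‖G n x‖ = ‖∫ x, G n x‖ := by
      rw [h1, Complex.norm_of_nonneg (integral_nonneg fun x => norm_nonneg _)]
    have h3 : ∫ x, G n x = ∫ x, regPow (1 / ((n : ℝ) + 1)) σ (t ^ 2 - P.q x) *
        (P.dilation χ x : ℂ) := by
      rw [← integral_deriv_comp_mul (contDiff_regPow (hn0 n) hσ') (fun s hs => regPow_of_nonpos hs)
        hχ ht]
      simp only [hG, (hasDerivAt_regPow (hn0 n) hσ' _).deriv]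
    rw [h2, h3]
    refine norm_integral_le_of_norm_le hDi.norm (Eventually.of_forall fun x => ?_)
    rw [norm_mul, norm_mul]
    exact mul_le_mul_of_nonneg_right (norm_regPow_le (hn0 n) _) (norm_nonneg _)
  have hF : Integrable fun x => ((σ : ℂ) + 1) *
      (posPow σ (t ^ 2 - P.q x) * ((P.q x * χ x : ℝ) : ℂ)) := by
    refine ⟨(aestronglyMeasurable_mul (measurable_posPow _) (fun s hs => posPow_of_nonpos hs _)
      hqχ ht).const_mul _, ?_⟩
    have hpt : ∀ x, Tendsto (fun n => G n x) atTop
        (𝓝 (((σ : ℂ) + 1) * (posPow σ (t ^ 2 - P.q x) * ((P.q x * χ x : ℝ) : ℂ)))) := fun x => by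
      rw [← mul_assoc]
      exact ((tendsto_regPowDeriv σ (t ^ 2 - P.q x)).comp hlim).mul_const _
    have hle : ∫⁻ x, ‖((σ : ℂ) + 1) * (posPow σ (t ^ 2 - P.q x) * ((P.q x * χ x : ℝ) : ℂ))‖ₑ ≤
        ENNReal.ofReal M := by
      calc _ = ∫⁻ x, liminf (fun n => ‖G n x‖ₑ) atTop :=
            lintegral_congr fun x => ((hpt x).enorm.liminf_eq).symm
        _ ≤ liminf (fun n => ∫⁻ x, ‖G n x‖ₑ) atTop :=
            lintegral_liminf_le' fun n => (hGi n).1.enorm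
        _ ≤ _ := by
            refine liminf_le_of_frequently_le' (Frequently.of_forall fun n => ?_)
            rw [← ofReal_integral_norm_eq_lintegral_enorm (hGi n)]
            exact ENNReal.ofReal_le_ofReal (hbound n)
    exact hle.trans_lt ENNReal.ofReal_lt_top
  have hσ1 : (σ : ℂ) + 1 ≠ 0 := by
    exact_mod_cast (by linarith : σ + 1 ≠ 0)
  have := hF.const_mul ((σ : ℂ) + 1)⁻¹
  simpa [← mul_assoc, inv_mul_cancel₀ hσ1] using this

/-- Absolute convergence of the integral defining `f₊^z[t² - q]` for `Re z > -1`. -/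
lemma IsAmplitude.integrable_posPow_mul {ψ : E → ℝ} (hψ : P.IsAmplitude ψ) {z : ℂ}
    (hz : -1 < z.re) {t : ℝ} (ht0 : 0 < t) (ht : t ^ 2 < P.T ^ 2) :
    Integrable fun x => posPow z (t ^ 2 - P.q x) * (ψ x : ℂ) := by
  obtain ⟨R, hR⟩ := hψ.2
  obtain ⟨χ, hχ, hχc, hχs, hχ0, hχ1⟩ := P.exists_cutoff R
  obtain ⟨C, hC0, hC⟩ := exists_abs_le_of_q_le hψ.1.continuousOn hR ht
  have h1 := (integrable_posPow_mul_q hz hχ hχ0 ht).norm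
  have h2 := hχc.integrable_of_hasCompactSupport hχs (μ := volume)
  set M := (t ^ 2 / 2) ^ z.re + (t ^ 2) ^ z.re with hM
  refine (((h1.const_mul (2 / t ^ 2)).add (h2.const_mul M)).const_mul C).mono'
    (aestronglyMeasurable_mul (measurable_posPow _) (fun s hs => posPow_of_nonpos hs _)
      hψ.1.continuousOn ht) (Eventually.of_forall fun x => ?_)
  have hM0 : 0 ≤ M := by positivity
  have hR0 : 0 ≤ 2 / t ^ 2 * ‖posPow (z.re : ℂ) (t ^ 2 - P.q x) * ((P.q x * χ x : ℝ) : ℂ)‖ +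
      M * χ x := by have := hχ0 x; positivity
  rcases le_or_gt (t ^ 2 - P.q x) 0 with hs | hs
  · rw [posPow_of_nonpos hs, zero_mul, norm_zero]
    exact mul_nonneg hC0 hR0
  rcases lt_or_ge R ‖x‖ with hx | hx
  · rw [hR x hx, Complex.ofReal_zero, mul_zero, norm_zero]
    exact mul_nonneg hC0 hR0
  have hψx : ‖(ψ x : ℂ)‖ ≤ C := by
    rw [Complex.norm_real]; exact hC x (by linarith)
  rw [norm_mul, norm_posPow hs, mul_comm]
  refine mul_le_mul hψx ?_ (by positivity) hC0
  have hq := P.q_nonneg x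
  have hspow : 0 ≤ (t ^ 2 - P.q x) ^ z.re := by positivity
  have ht2 : 0 < t ^ 2 := by positivity
  simp only [Pi.add_apply, hχ1 x hx, mul_one]
  rw [norm_mul, norm_posPow hs, Complex.ofReal_re, Complex.norm_of_nonneg hq]
  rcases le_or_gt (t ^ 2 / 2) (P.q x) with hq2 | hq2
  -- near the wave front the factor `q` is bounded below
  · have : 1 ≤ 2 / t ^ 2 * P.q x := by
      rw [div_mul_eq_mul_div, le_div_iff₀ ht2]; linarith
    nlinarith [mul_le_mul_of_nonneg_left this hspow]
  -- elsewhere the power is bounded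
  · have hle : (t ^ 2 - P.q x) ^ z.re ≤ M := by
      rcases le_total 0 z.re with h | h
      · have h1 : (t ^ 2 - P.q x) ^ z.re ≤ (t ^ 2) ^ z.re :=
          Real.rpow_le_rpow hs.le (by linarith) h
        have h2 : 0 ≤ (t ^ 2 / 2) ^ z.re := by positivity
        linarith
      · have h1 : (t ^ 2 - P.q x) ^ z.re ≤ (t ^ 2 / 2) ^ z.re :=
          Real.rpow_le_rpow_of_nonpos (by positivity) (by linarith) h
        have h2 : 0 ≤ (t ^ 2) ^ z.re := by positivity
        linarith
    have : 0 ≤ 2 / t ^ 2 * ((t ^ 2 - P.q x) ^ z.re * P.q x) := by positivity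
    linarith

/-- The divergence theorem for `(t² - q)₊^(z+1) ψ W`, for all `Re z > -1`. -/
lemma IsAmplitude.integral_posPow_mul_q {ψ : E → ℝ} (hψ : P.IsAmplitude ψ) {z : ℂ}
    (hz : -1 < z.re) {t : ℝ} (ht0 : 0 < t) (ht : t ^ 2 < P.T ^ 2) :
    (z + 1) * ∫ x, posPow z (t ^ 2 - P.q x) * ((P.q x * ψ x : ℝ) : ℂ) =
      ∫ x, posPow (z + 1) (t ^ 2 - P.q x) * (P.dilation ψ x : ℂ) := by
  obtain ⟨R, hR⟩ := hψ.2
  have hqψ : ContinuousOn (fun x => P.q x * ψ x) P.U :=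
    P.continuous_q.continuousOn.mul hψ.1.continuousOn
  have hqψA : P.IsAmplitude fun x => P.q x * ψ x :=
    ⟨P.contDiffOn_q.mul hψ.1, R, fun x hx => by simp [hR x hx]⟩
  have hpos : ∀ᶠ ε : ℝ in 𝓝[>] 0, 0 < ε := self_mem_nhdsWithin
  have h1 : Tendsto (fun ε => ∫ x, regPowDeriv ε z (t ^ 2 - P.q x) * ((P.q x * ψ x : ℝ) : ℂ))
      (𝓝[>] 0) (𝓝 (∫ x, (z + 1) * posPow z (t ^ 2 - P.q x) * ((P.q x * ψ x : ℝ) : ℂ))) := by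
    refine tendsto_integral_filter_of_dominated_convergence
      (fun x => (‖z‖ + 3) * ‖posPow z (t ^ 2 - P.q x) * ((P.q x * ψ x : ℝ) : ℂ)‖) ?_ ?_
      ((hqψA.integrable_posPow_mul hz ht0 ht).norm.const_mul _) ?_
    · filter_upwards [hpos] with ε hε
      exact aestronglyMeasurable_mul (continuous_regPowDeriv hε hz).measurable
        (fun s hs => by simp [regPowDeriv, posPow_of_nonpos hs]) hqψ ht
    · filter_upwards [hpos] with ε hε
      refine Eventually.of_forall fun x => ?_
      rw [norm_mul, norm_mul, ← mul_assoc]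
      exact mul_le_mul_of_nonneg_right (norm_regPowDeriv_le hε _) (norm_nonneg _)
    · exact Eventually.of_forall fun x => (tendsto_regPowDeriv z _).mul_const _
  have h2 : Tendsto (fun ε => ∫ x, regPow ε z (t ^ 2 - P.q x) * (P.dilation ψ x : ℂ))
      (𝓝[>] 0) (𝓝 (∫ x, posPow (z + 1) (t ^ 2 - P.q x) * (P.dilation ψ x : ℂ))) := by
    refine tendsto_integral_filter_of_dominated_convergence
      (fun x => ‖posPow (z + 1) (t ^ 2 - P.q x) * (P.dilation ψ x : ℂ)‖) ?_ ?_
      (hψ.dilation.integrable_posPow_mul (by simp; linarith) ht0 ht).norm ?_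
    · filter_upwards [hpos] with ε hε
      exact aestronglyMeasurable_mul (contDiff_regPow hε hz).continuous.measurable
        (fun s hs => regPow_of_nonpos hs) hψ.dilation.1.continuousOn ht
    · filter_upwards [hpos] with ε hε
      refine Eventually.of_forall fun x => ?_
      rw [norm_mul, norm_mul]
      exact mul_le_mul_of_nonneg_right (norm_regPow_le hε _) (norm_nonneg _)
    · exact Eventually.of_forall fun x => (tendsto_regPow z _).mul_const _
  have h3 := tendsto_nhds_unique (h1.congr' ?_) h2
  · simp_rw [mul_assoc] at h3
    rwa [integral_const_mul] at h3
  · filter_upwards [hpos] with ε hε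
    rw [← integral_deriv_comp_mul (contDiff_regPow hε hz) (fun s hs => regPow_of_nonpos hs) hψ ht]
    simp only [(hasDerivAt_regPow hε hz _).deriv]

variable (P) in
/-- The integral `∫ f₊^z[t² - q] ψ`, meaningful for `Re z > -1`. -/
noncomputable def gsIntegral (z : ℂ) (t : ℝ) (ψ : E → ℝ) : ℂ :=
  ∫ x, gsFun z (t ^ 2 - P.q x) * (ψ x : ℂ)

lemma IsAmplitude.integrable_gsFun_mul {ψ : E → ℝ} (hψ : P.IsAmplitude ψ) {z : ℂ}
    (hz : -1 < z.re) {t : ℝ} (ht0 : 0 < t) (ht : t ^ 2 < P.T ^ 2) :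
    Integrable fun x => gsFun z (t ^ 2 - P.q x) * (ψ x : ℂ) := by
  have := (hψ.integrable_posPow_mul hz ht0 ht).div_const (Complex.Gamma (z + 1))
  refine this.congr (Eventually.of_forall fun x => ?_)
  simp only [gsFun_eq]; ring

/-- The recursion that continues `∫ f₊^z[t² - q] ψ` analytically to the left. -/
lemma IsAmplitude.sq_mul_gsIntegral {ψ : E → ℝ} (hψ : P.IsAmplitude ψ) {z : ℂ}
    (hz : -1 < z.re) {t : ℝ} (ht0 : 0 < t) (ht : t ^ 2 < P.T ^ 2) :
    (t : ℂ) ^ 2 * P.gsIntegral z t ψ =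
      (z + 1) * P.gsIntegral (z + 1) t ψ + P.gsIntegral (z + 1) t (P.dilation ψ) := by
  obtain ⟨R, hR⟩ := hψ.2
  have hqψA : P.IsAmplitude fun x => P.q x * ψ x :=
    ⟨P.contDiffOn_q.mul hψ.1, R, fun x hx => by simp [hR x hx]⟩
  have hz1 : z + 1 ≠ 0 := fun h => by
    have := congrArg Complex.re h
    simp at this; linarith
  have hΓ : Complex.Gamma (z + 1) ≠ 0 := Complex.Gamma_ne_zero_of_re_pos (by simp; linarith)
  have hI : ∀ w φ, P.gsIntegral w t φ =
      (∫ x, posPow w (t ^ 2 - P.q x) * (φ x : ℂ)) / Complex.Gamma (w + 1) := fun w φ => by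
    rw [← integral_div]
    refine integral_congr_ae (Eventually.of_forall fun x => ?_)
    simp only [gsFun_eq]; ring
  have hsplit : (t : ℂ) ^ 2 * ∫ x, posPow z (t ^ 2 - P.q x) * (ψ x : ℂ) =
      (∫ x, posPow (z + 1) (t ^ 2 - P.q x) * (ψ x : ℂ)) +
        ∫ x, posPow z (t ^ 2 - P.q x) * ((P.q x * ψ x : ℝ) : ℂ) := by
    rw [← integral_add (hψ.integrable_posPow_mul (by simp; linarith) ht0 ht)
      (hqψA.integrable_posPow_mul hz ht0 ht), ← integral_const_mul]
    refine integral_congr_ae (Eventually.of_forall fun x => ?_)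
    simp only [posPow_add_one]
    push_cast
    ring
  have hdiv := hψ.integral_posPow_mul_q hz ht0 ht
  rw [hI, hI, hI, Complex.Gamma_add_one _ hz1, ← hdiv, mul_div_assoc', hsplit]
  field_simp

end SquaredPhase

/-! ### Analytic continuation and differentiation in time -/

namespace SquaredPhase

variable {E : Type*} [NormedAddCommGroup E] [InnerProductSpace ℝ E] {P : SquaredPhase E}

lemma sq_lt_sq_T {s : ℝ} (hs : s ∈ Ioo 0 P.T) : s ^ 2 < P.T ^ 2 :=
  pow_lt_pow_left₀ hs.2 hs.1.le two_ne_zero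

variable [FiniteDimensional ℝ E] [MeasurableSpace E] [BorelSpace E]

lemma IsAmplitude.exists_integrable_bound {ψ : E → ℝ} (hψ : P.IsAmplitude ψ) {t : ℝ}
    (ht : t ^ 2 < P.T ^ 2) :
    ∃ g : E → ℝ, Integrable g ∧ (∀ x, 0 ≤ g x) ∧ ∀ x, P.q x ≤ t ^ 2 → ‖(ψ x : ℂ)‖ ≤ g x := by
  obtain ⟨R, hR⟩ := hψ.2
  obtain ⟨χ, -, hχc, hχs, hχ0, hχ1⟩ := P.exists_cutoff R
  obtain ⟨C, hC0, hC⟩ := exists_abs_le_of_q_le hψ.1.continuousOn hR ht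
  refine ⟨fun x => C * χ x, (hχc.integrable_of_hasCompactSupport hχs).const_mul C,
    fun x => mul_nonneg hC0 (hχ0 x), fun x hx => ?_⟩
  rcases lt_or_ge R ‖x‖ with h | h
  · rw [hR x h, Complex.ofReal_zero, norm_zero]
    exact mul_nonneg hC0 (hχ0 x)
  · simpa [hχ1 x h] using hC x hx

/-- On `(0, M]` the function `s^w log s` is bounded, locally uniformly in `Re w > 1`. -/
lemma norm_posPow_mul_log_le {w : ℂ} {A M s : ℝ} (hw : 1 < w.re) (hwA : w.re ≤ A) (hM : 1 ≤ M)
    (hsM : s ≤ M) : ‖posPow w s * (Real.log s : ℂ)‖ ≤ 1 + M ^ A * M := by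
  have hM0 : 0 < M := by linarith
  rcases le_or_gt s 0 with hs | hs
  · rw [posPow_of_nonpos hs, zero_mul, norm_zero]; positivity
  rw [norm_mul, norm_posPow hs, Complex.norm_real, Real.norm_eq_abs]
  rcases le_total s 1 with h1 | h1
  · have h2 : s ^ w.re ≤ s := by
      simpa using Real.rpow_le_rpow_of_exponent_ge hs h1 hw.le
    have h3 := (Real.abs_log_mul_self_lt s hs h1).le
    rw [abs_mul, abs_of_pos hs, mul_comm] at h3
    have h4 : 0 ≤ M ^ A * M := by positivity
    linarith [mul_le_mul_of_nonneg_right h2 (abs_nonneg (Real.log s))]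
  · have h2 : s ^ w.re ≤ M ^ A :=
      (Real.rpow_le_rpow hs.le hsM (by linarith)).trans (Real.rpow_le_rpow_of_exponent_le hM hwA)
    have h3 : |Real.log s| ≤ M := by
      rw [abs_of_nonneg (Real.log_nonneg h1)]
      linarith [Real.log_le_sub_one_of_pos hs]
    have := mul_le_mul h2 h3 (abs_nonneg _) (by positivity)
    linarith

lemma IsAmplitude.differentiableAt_gsIntegral {ψ : E → ℝ} (hψ : P.IsAmplitude ψ) {z₀ : ℂ}
    (hz : 1 < z₀.re) {t : ℝ} (ht0 : 0 < t) (ht : t ^ 2 < P.T ^ 2) :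
    DifferentiableAt ℂ (fun z => P.gsIntegral z t ψ) z₀ := by
  have hI : (fun z => P.gsIntegral z t ψ) = fun z =>
      (∫ x, posPow z (t ^ 2 - P.q x) * (ψ x : ℂ)) * (Complex.Gamma (z + 1))⁻¹ := by
    ext z
    rw [← integral_mul_const]
    refine integral_congr_ae (Eventually.of_forall fun x => ?_)
    simp only [gsFun_eq]; ring
  rw [hI]
  refine DifferentiableAt.mul ?_ ((Complex.differentiable_one_div_Gamma.comp
    (differentiable_id.add_const (1 : ℂ))) z₀)
  obtain ⟨g, hg, hg0, hgψ⟩ := hψ.exists_integrable_bound ht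
  have hball : ∀ w ∈ Metric.ball z₀ (z₀.re - 1), 1 < w.re ∧ w.re ≤ 2 * z₀.re := fun w hw => by
    have h1 : |(w - z₀).re| < z₀.re - 1 :=
      (Complex.abs_re_le_norm _).trans_lt (mem_ball_iff_norm.1 hw)
    rw [Complex.sub_re, abs_lt] at h1
    constructor <;> linarith [h1.1, h1.2]
  set M := max 1 (t ^ 2) with hM
  refine (hasDerivAt_integral_of_dominated_loc_of_deriv_le (μ := volume)
    (F := fun z x => posPow z (t ^ 2 - P.q x) * (ψ x : ℂ))
    (F' := fun z x => posPow z (t ^ 2 - P.q x) * (Real.log (t ^ 2 - P.q x) : ℂ) * (ψ x : ℂ))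
    (bound := fun x => (1 + M ^ (2 * z₀.re) * M) * g x)
    (Metric.ball_mem_nhds z₀ (sub_pos.2 hz)) ?_ (hψ.integrable_posPow_mul (by linarith) ht0 ht)
    ?_ ?_ (hg.const_mul _) ?_).2.differentiableAt
  · exact Eventually.of_forall fun z => aestronglyMeasurable_mul (measurable_posPow z)
      (fun s hs => posPow_of_nonpos hs z) hψ.1.continuousOn ht
  · exact aestronglyMeasurable_mul (h := fun s => posPow z₀ s * (Real.log s : ℂ))
      ((measurable_posPow z₀).mul (Complex.measurable_ofReal.comp Real.measurable_log))
      (fun s hs => by simp [posPow_of_nonpos hs]) hψ.1.continuousOn ht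
  · refine Eventually.of_forall fun x w hw => ?_
    have hb := norm_posPow_mul_log_le (hball w hw).1 (hball w hw).2 (le_max_left 1 (t ^ 2))
      (s := t ^ 2 - P.q x) ((sub_le_self _ (P.q_nonneg x)).trans (le_max_right _ _))
    rw [norm_mul]
    rcases le_or_gt (P.q x) (t ^ 2) with h | h
    · exact mul_le_mul hb (hgψ x h) (norm_nonneg _) ((norm_nonneg _).trans hb)
    · rw [posPow_of_nonpos (by linarith), zero_mul, norm_zero, zero_mul]
      exact mul_nonneg ((norm_nonneg _).trans hb) (hg0 x)
  · refine Eventually.of_forall fun x w _ => HasDerivAt.mul_const ?_ _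
    rcases le_or_gt (t ^ 2 - P.q x) 0 with h | h
    · simp only [posPow_of_nonpos h, zero_mul]
      exact hasDerivAt_const w 0
    · have hne : ((t ^ 2 - P.q x : ℝ) : ℂ) ≠ 0 := Complex.ofReal_ne_zero.2 h.ne'
      have := (hasDerivAt_id w).const_cpow (c := ((t ^ 2 - P.q x : ℝ) : ℂ)) (Or.inl hne)
      simp only [posPow_of_pos h, Complex.ofReal_log h.le]
      simpa using this

lemma IsAmplitude.hasDerivAt_gsIntegral_add_one {ψ : E → ℝ} (hψ : P.IsAmplitude ψ) {z : ℂ}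
    (hz : 0 < z.re) {t : ℝ} (ht : t ∈ Ioo 0 P.T) :
    HasDerivAt (fun s : ℝ => P.gsIntegral (z + 1) s ψ) (2 * t * P.gsIntegral z t ψ) t := by
  set t₁ := (t + P.T) / 2 with ht₁
  have h01 : 0 < t₁ := by linarith [ht.1, P.T_pos]
  have htt₁ : t < t₁ := by linarith [ht.2]
  have hsq : ∀ s ∈ Ioo 0 t₁, s ^ 2 ≤ t₁ ^ 2 := fun s hs =>
    pow_le_pow_left₀ hs.1.le hs.2.le 2
  have hT₁ : t₁ ^ 2 < P.T ^ 2 := pow_lt_pow_left₀ (by linarith [ht.2]) h01.le two_ne_zero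
  have htmem : t ∈ Ioo 0 t₁ := ⟨ht.1, htt₁⟩
  obtain ⟨g, hg, hg0, hgψ⟩ := hψ.exists_integrable_bound hT₁
  obtain ⟨B, hB⟩ := (isCompact_Icc (a := (0 : ℝ)) (b := t₁ ^ 2)).exists_bound_of_continuousOn
    (continuous_gsFun hz).continuousOn
  have hz1 : -1 < (z + 1).re := by simp; linarith
  have key := (hasDerivAt_integral_of_dominated_loc_of_deriv_le (μ := volume)
    (F := fun (s : ℝ) x => gsFun (z + 1) (s ^ 2 - P.q x) * (ψ x : ℂ))
    (F' := fun (s : ℝ) x => (2 * s : ℂ) * (gsFun z (s ^ 2 - P.q x) * (ψ x : ℂ)))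
    (bound := fun x => 2 * t₁ * (|B| * g x))
    (Ioo_mem_nhds ht.1 htt₁) ?_ (hψ.integrable_gsFun_mul hz1 ht.1 ((hsq t htmem).trans_lt hT₁))
    ?_ ?_ ((hg.const_mul _).const_mul _) ?_).2
  · refine key.congr_deriv ?_
    rw [gsIntegral, ← integral_const_mul]
  · filter_upwards [Ioo_mem_nhds ht.1 htt₁] with s hs
    exact (hψ.integrable_gsFun_mul hz1 hs.1 ((hsq s hs).trans_lt hT₁)).1
  · exact (hψ.integrable_gsFun_mul (by linarith) ht.1 ((hsq t htmem).trans_lt hT₁)).1.const_mul _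
  · refine Eventually.of_forall fun x s hs => ?_
    have e1 : ‖(2 * s : ℂ)‖ ≤ 2 * t₁ := by
      rw [norm_mul, Complex.norm_real, Real.norm_of_nonneg hs.1.le]
      simpa using hs.2.le
    rw [norm_mul]
    refine mul_le_mul e1 ?_ (norm_nonneg _) (by linarith)
    rw [norm_mul]
    rcases le_or_gt (s ^ 2 - P.q x) 0 with h | h
    · rw [gsFun_of_nonpos h, norm_zero, zero_mul]
      exact mul_nonneg (abs_nonneg B) (hg0 x)
    · refine mul_le_mul ((hB _ ⟨h.le, ?_⟩).trans (le_abs_self B)) (hgψ x ?_) (norm_nonneg _)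
        (abs_nonneg B)
      · linarith [hsq s hs, P.q_nonneg x]
      · linarith [hsq s hs]
  · refine Eventually.of_forall fun x s _ => ?_
    have h1 : HasDerivAt (fun s : ℝ => s ^ 2 - P.q x) (2 * s) s := by
      simpa using (hasDerivAt_pow 2 s).sub_const (P.q x)
    have h2 := (hasDerivAt_gsFun_add_one hz (s ^ 2 - P.q x)).scomp s h1
    refine (h2.mul_const (ψ x : ℂ)).congr_deriv ?_
    simp [mul_assoc]

variable (P) in
/-- `∫ f₊^z[t² - q] ψ` continued to `Re z > -1 - k` by `k` steps of the recursion. -/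
noncomputable def gsIter : ℕ → ℂ → ℝ → (E → ℝ) → ℂ
  | 0, z, t, ψ => P.gsIntegral z t ψ
  | k + 1, z, t, ψ =>
    ((z + 1) * gsIter k (z + 1) t ψ + gsIter k (z + 1) t (P.dilation ψ)) / (t : ℂ) ^ 2

lemma gsIter_succ_eq {t : ℝ} (ht0 : 0 < t) (ht : t ^ 2 < P.T ^ 2) (k : ℕ) :
    ∀ {ψ : E → ℝ} (_ : P.IsAmplitude ψ) {z : ℂ} (_ : -1 - (k : ℝ) < z.re),
      P.gsIter (k + 1) z t ψ = P.gsIter k z t ψ := by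
  induction k with
  | zero =>
    intro ψ hψ z hz
    have ht' : (t : ℂ) ^ 2 ≠ 0 := pow_ne_zero 2 (Complex.ofReal_ne_zero.2 ht0.ne')
    rw [gsIter, gsIter, gsIter, gsIter, ← hψ.sq_mul_gsIntegral (by simpa using hz) ht0 ht,
      mul_div_cancel_left₀ _ ht']
  | succ k ih =>
    intro ψ hψ z hz
    push_cast at hz
    rw [gsIter, ih hψ (by simp; linarith), ih hψ.dilation (by simp; linarith), ← gsIter]

lemma gsIter_eq_of_le {t : ℝ} (ht0 : 0 < t) (ht : t ^ 2 < P.T ^ 2) {ψ : E → ℝ}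
    (hψ : P.IsAmplitude ψ) {z : ℂ} {k l : ℕ} (hkl : k ≤ l) (hz : -1 - (k : ℝ) < z.re) :
    P.gsIter l z t ψ = P.gsIter k z t ψ := by
  induction l, hkl using Nat.le_induction with
  | base => rfl
  | succ l hl ih =>
    have : (k : ℝ) ≤ l := by exact_mod_cast hl
    rw [gsIter_succ_eq ht0 ht l hψ (by linarith), ih]

lemma differentiableAt_gsIter {t : ℝ} (ht0 : 0 < t) (ht : t ^ 2 < P.T ^ 2) (k : ℕ) :
    ∀ {ψ : E → ℝ} (_ : P.IsAmplitude ψ) {z₀ : ℂ} (_ : 1 - (k : ℝ) < z₀.re),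
      DifferentiableAt ℂ (fun z => P.gsIter k z t ψ) z₀ := by
  induction k with
  | zero => exact fun hψ z₀ hz => hψ.differentiableAt_gsIntegral (by simpa using hz) ht0 ht
  | succ k ih =>
    intro ψ hψ z₀ hz
    push_cast at hz
    have hs : DifferentiableAt ℂ (fun z : ℂ => z + 1) z₀ := by fun_prop
    have h1 := (ih hψ (z₀ := z₀ + 1) (by simp; linarith)).comp z₀ hs
    have h2 := (ih hψ.dilation (z₀ := z₀ + 1) (by simp; linarith)).comp z₀ hs
    exact ((hs.mul h1).add h2).div_const _

variable (P) in
/-- The analytic continuation of `∫ f₊^z[t² - q] ψ` to all complex `z`. Any number of steps greater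
than `-1 - Re z` gives the same value. -/
noncomputable def gsCont (z : ℂ) (t : ℝ) (ψ : E → ℝ) : ℂ := P.gsIter ⌈1 - z.re⌉₊ z t ψ

section gsCont

variable {ψ : E → ℝ} {t : ℝ}

lemma gsCont_eq_gsIter (ht0 : 0 < t) (ht : t ^ 2 < P.T ^ 2) (hψ : P.IsAmplitude ψ) {z : ℂ} {k : ℕ}
    (hz : -1 - (k : ℝ) < z.re) : P.gsCont z t ψ = P.gsIter k z t ψ := by
  have h := Nat.le_ceil (1 - z.re)
  rw [gsCont, ← gsIter_eq_of_le ht0 ht hψ (le_max_left _ k) (by linarith),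
    gsIter_eq_of_le ht0 ht hψ (le_max_right _ k) hz]

lemma gsCont_eq_gsIntegral (ht0 : 0 < t) (ht : t ^ 2 < P.T ^ 2) (hψ : P.IsAmplitude ψ) {z : ℂ}
    (hz : -1 < z.re) : P.gsCont z t ψ = P.gsIntegral z t ψ :=
  gsCont_eq_gsIter (k := 0) ht0 ht hψ (by simpa using hz)

lemma sq_mul_gsCont (ht0 : 0 < t) (ht : t ^ 2 < P.T ^ 2) (hψ : P.IsAmplitude ψ) (z : ℂ) :
    (t : ℂ) ^ 2 * P.gsCont z t ψ =
      (z + 1) * P.gsCont (z + 1) t ψ + P.gsCont (z + 1) t (P.dilation ψ) := by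
  obtain ⟨k, hk⟩ := exists_nat_gt (-z.re)
  have ht' : (t : ℂ) ^ 2 ≠ 0 := pow_ne_zero 2 (Complex.ofReal_ne_zero.2 ht0.ne')
  have hk1 : -1 - (k : ℝ) < (z + 1).re := by simp; linarith
  rw [gsCont_eq_gsIter (k := k + 1) ht0 ht hψ (by push_cast; linarith),
    gsCont_eq_gsIter ht0 ht hψ hk1, gsCont_eq_gsIter ht0 ht hψ.dilation hk1, gsIter,
    mul_div_cancel₀ _ ht']

lemma differentiable_gsCont (ht0 : 0 < t) (ht : t ^ 2 < P.T ^ 2) (hψ : P.IsAmplitude ψ) :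
    Differentiable ℂ fun z => P.gsCont z t ψ := fun z₀ => by
  obtain ⟨k, hk⟩ := exists_nat_gt (1 - z₀.re)
  refine (differentiableAt_gsIter ht0 ht k hψ (by linarith)).congr_of_eventuallyEq ?_
  have : {z : ℂ | 1 - (k : ℝ) < z.re} ∈ 𝓝 z₀ :=
    (isOpen_lt continuous_const Complex.continuous_re).mem_nhds
      (show 1 - (k : ℝ) < z₀.re by linarith)
  filter_upwards [this] with z hz
  have hz' : 1 - (k : ℝ) < z.re := hz
  exact gsCont_eq_gsIter ht0 ht hψ (by linarith)

/-- Differentiation in time lowers the exponent by one; the recursion carries this from large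
`Re z`, where one differentiates under the integral, to all `z`. -/
lemma hasDerivAt_gsCont_add_one (ht : t ∈ Ioo 0 P.T) (hψ : P.IsAmplitude ψ) (z : ℂ) :
    HasDerivAt (fun s : ℝ => P.gsCont (z + 1) s ψ) (2 * t * P.gsCont z t ψ) t := by
  have hnhds : Ioo 0 P.T ∈ 𝓝 t := Ioo_mem_nhds ht.1 ht.2
  obtain ⟨k, hk⟩ := exists_nat_gt (-z.re)
  induction k generalizing z ψ with
  | zero =>
    have hz : 0 < z.re := by simpa using hk
    rw [gsCont_eq_gsIntegral ht.1 (sq_lt_sq_T ht) hψ (by linarith)]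
    refine (hψ.hasDerivAt_gsIntegral_add_one hz ht).congr_of_eventuallyEq ?_
    filter_upwards [hnhds] with s hs
    exact gsCont_eq_gsIntegral hs.1 (sq_lt_sq_T hs) hψ (by simp; linarith)
  | succ k ih =>
    push_cast at hk
    have h1 := ih hψ (z + 1) (by simp; linarith)
    have h2 := ih hψ.dilation (z + 1) (by simp; linarith)
    have ht' : (t : ℂ) ≠ 0 := Complex.ofReal_ne_zero.2 ht.1.ne'
    have hsq : HasDerivAt (fun s : ℝ => (s : ℂ) ^ 2) (2 * t) t := by
      simpa [Pi.pow_def] using (hasDerivAt_id t).ofReal_comp.pow 2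
    have hd := ((h1.const_mul (z + 1 + 1)).add h2).div hsq (pow_ne_zero 2 ht')
    have e1 := sq_mul_gsCont ht.1 (sq_lt_sq_T ht) hψ (z + 1)
    have e2 := sq_mul_gsCont ht.1 (sq_lt_sq_T ht) hψ z
    refine HasDerivAt.congr_of_eventuallyEq (hd.congr_deriv ?_) ?_
    · simp only [Pi.add_apply]
      rw [← e1, div_eq_iff (pow_ne_zero 2 (pow_ne_zero 2 ht'))]
      linear_combination (-2 * (t : ℂ) ^ 3) * e2
    · filter_upwards [hnhds] with s hs
      have hs' : (s : ℂ) ^ 2 ≠ 0 := pow_ne_zero 2 (Complex.ofReal_ne_zero.2 hs.1.ne')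
      simp only [Pi.div_apply, Pi.add_apply]
      rw [eq_div_iff hs', mul_comm, sq_mul_gsCont hs.1 (sq_lt_sq_T hs) hψ (z + 1)]

end gsCont

end SquaredPhase

/-! ### The model integral -/

lemma gsFun_ofReal {p : ℝ} (hp : 0 < p) (s : ℝ) :
    gsFun p s = ((max s 0 ^ p / Real.Gamma (p + 1) : ℝ) : ℂ) := by
  rcases le_or_gt s 0 with hs | hs
  · rw [gsFun_of_nonpos hs, max_eq_right hs, Real.zero_rpow hp.ne', zero_div, Complex.ofReal_zero]
  · rw [gsFun_eq, posPow_of_pos hs, max_eq_left hs.le, Complex.ofReal_div,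
      Complex.ofReal_cpow hs.le, ← Complex.Gamma_ofReal]
    push_cast
    rfl

/-- The constant in `∫ f₊^p[t² - n₀² |x|²] dx = leadCoeff d n₀ p * t^(d+2p)` in dimension `d`. -/
noncomputable def leadCoeff (d : ℕ) (n₀ p : ℝ) : ℝ :=
  Real.pi ^ ((d : ℝ) / 2) / (n₀ ^ d * Real.Gamma (p + 1 + d / 2))

/-- The radial part of the model integral is a Beta integral in the variable `|x|²`. -/
lemma integral_radial_gsFun {d : ℕ} (hd : 0 < d) {n₀ p t : ℝ} (hn : 0 < n₀) (hp : 0 < p)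
    (ht : 0 < t) :
    ∫ y in Ioi (0 : ℝ), y ^ (d - 1) • gsFun p (t ^ 2 - n₀ ^ 2 * y ^ 2) =
      ((Real.Gamma (d / 2) / (2 * n₀ ^ d * Real.Gamma (p + 1 + d / 2)) *
        t ^ ((d : ℝ) + 2 * p) : ℝ) : ℂ) := by
  set a : ℝ := (t / n₀) ^ 2 with ha
  have ha0 : 0 < a := by positivity
  have hd' : (0 : ℝ) < d := Nat.cast_pos.2 hd
  set g : ℝ → ℂ := fun u => ((u ^ ((d : ℝ) / 2 - 1) / 2 : ℝ) : ℂ) * gsFun p (t ^ 2 - n₀ ^ 2 * u)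
    with hg
  have hΓp : 0 < Real.Gamma (p + 1) := Real.Gamma_pos_of_pos (by linarith)
  have h1 : ∫ y in Ioi (0 : ℝ), y ^ (d - 1) • gsFun p (t ^ 2 - n₀ ^ 2 * y ^ 2) =
      ∫ u in Ioi (0 : ℝ), g u := by
    rw [← integral_comp_rpow_Ioi_of_pos (g := g) (p := 2) two_pos]
    refine setIntegral_congr_fun measurableSet_Ioi fun y (hy : 0 < y) => ?_
    have e1 : y ^ (2 : ℝ) = y ^ 2 := Real.rpow_two y
    have e2 : (y ^ 2) ^ ((d : ℝ) / 2 - 1) * y = y ^ (d - 1) := by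
      rw [← Real.rpow_natCast y 2, ← Real.rpow_mul hy.le, ← Real.rpow_natCast y (d - 1),
        ← Real.rpow_add_one hy.ne']
      congr 1
      rw [Nat.cast_sub hd]
      push_cast
      ring
    simp only [hg, e1, Complex.real_smul, ← e2]
    norm_num
    ring
  have h2 : ∫ u in Ioi (0 : ℝ), g u = ∫ u in (0 : ℝ)..a, g u := by
    rw [intervalIntegral.integral_of_le ha0.le]
    refine setIntegral_eq_of_subset_of_forall_sdiff_eq_zero measurableSet_Ioi
      Ioc_subset_Ioi_self fun u hu => ?_
    have hua : a < u := by
      by_contra hcon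
      exact hu.2 ⟨hu.1, not_lt.1 hcon⟩
    have : t ^ 2 - n₀ ^ 2 * u ≤ 0 := by
      have : n₀ ^ 2 * a = t ^ 2 := by rw [ha]; field_simp
      nlinarith [mul_le_mul_of_nonneg_left hua.le (sq_nonneg n₀)]
    simp only [hg, gsFun_of_nonpos this, mul_zero]
  have h3 : ∫ u in (0 : ℝ)..a, g u = ∫ u in (0 : ℝ)..a,
      (((n₀ ^ 2) ^ p / (2 * Real.Gamma (p + 1)) : ℝ) : ℂ) *
        ((u : ℂ) ^ (((d : ℂ) / 2) - 1) * ((a : ℂ) - u) ^ (((p : ℂ) + 1) - 1)) := by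
    refine intervalIntegral.integral_congr_ae (Eventually.of_forall fun u hu => ?_)
    rw [uIoc_of_le ha0.le] at hu
    have e0 : t ^ 2 - n₀ ^ 2 * u = n₀ ^ 2 * (a - u) := by rw [ha]; field_simp
    have hau : 0 ≤ a - u := by linarith [hu.2]
    simp only [hg]
    rw [gsFun_ofReal hp, e0, max_eq_left (by positivity), Real.mul_rpow (by positivity) hau,
      add_sub_cancel_right, ← Complex.ofReal_sub, ← Complex.ofReal_cpow hau,
      show (d : ℂ) / 2 - 1 = (((d : ℝ) / 2 - 1 : ℝ) : ℂ) by push_cast; rfl,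
      ← Complex.ofReal_cpow hu.1.le]
    norm_cast
    field_simp
  have h4 := Complex.betaIntegral_scaled ((d : ℂ) / 2) ((p : ℂ) + 1) ha0
  have h5 := Complex.betaIntegral_eq_Gamma_mul_div ((d : ℂ) / 2) ((p : ℂ) + 1)
    (by rw [show (d : ℂ) / 2 = ((d / 2 : ℝ) : ℂ) by push_cast; rfl, Complex.ofReal_re]; positivity)
    (by simp; linarith)
  have e3 : a ^ ((d : ℝ) / 2 + p) = t ^ ((d : ℝ) + 2 * p) / (n₀ ^ d * (n₀ ^ 2) ^ p) := by
    rw [ha, ← Real.rpow_natCast (t / n₀) 2, ← Real.rpow_mul (by positivity),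
      Real.div_rpow ht.le hn.le, ← Real.rpow_natCast n₀ 2, ← Real.rpow_mul hn.le,
      ← Real.rpow_natCast n₀ d, ← Real.rpow_add hn]
    push_cast
    congr 2 <;> ring
  have hΓ1 : Complex.Gamma ((d : ℂ) / 2) = (Real.Gamma (d / 2) : ℂ) := by
    rw [← Complex.Gamma_ofReal]; push_cast; rfl
  have hΓ2 : Complex.Gamma ((p : ℂ) + 1) = (Real.Gamma (p + 1) : ℂ) := by
    rw [← Complex.Gamma_ofReal]; push_cast; rfl
  have hΓ3 : Complex.Gamma ((d : ℂ) / 2 + ((p : ℂ) + 1)) = (Real.Gamma (p + 1 + d / 2) : ℂ) := by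
    rw [← Complex.Gamma_ofReal]; push_cast; congr 1; ring
  have h6 : (a : ℂ) ^ ((d : ℂ) / 2 + ((p : ℂ) + 1) - 1) = ((a ^ ((d : ℝ) / 2 + p) : ℝ) : ℂ) := by
    rw [Complex.ofReal_cpow ha0.le]
    congr 1
    push_cast
    ring
  rw [h1, h2, h3, intervalIntegral.integral_const_mul, h4, h5, hΓ1, hΓ2, hΓ3, h6, e3]
  norm_cast
  have : 0 < (n₀ ^ 2) ^ p := by positivity
  field_simp

section Model

variable {E : Type*} [NormedAddCommGroup E] [InnerProductSpace ℝ E] [FiniteDimensional ℝ E]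
  [MeasurableSpace E] [BorelSpace E] [Nontrivial E]

/-- The pairing for a homogeneous medium with a constant amplitude. -/
lemma integral_gsFun_norm_sq {n₀ p t : ℝ} (hn : 0 < n₀) (hp : 0 < p) (ht : 0 < t) :
    ∫ x : E, gsFun p (t ^ 2 - n₀ ^ 2 * ‖x‖ ^ 2) =
      ((leadCoeff (Module.finrank ℝ E) n₀ p *
        t ^ ((Module.finrank ℝ E : ℝ) + 2 * p) : ℝ) : ℂ) := by
  have hd : 0 < Module.finrank ℝ E := Module.finrank_pos
  have h := integral_fun_norm_addHaar (volume : Measure E)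
    (fun y => gsFun p (t ^ 2 - n₀ ^ 2 * y ^ 2))
  rw [h, integral_radial_gsFun hd hn hp ht]
  set d := Module.finrank ℝ E
  have hd' : (0 : ℝ) < d := Nat.cast_pos.2 hd
  have hvol : (volume : Measure E).real (Metric.ball 0 1) =
      Real.pi ^ ((d : ℝ) / 2) / (d / 2 * Real.Gamma (d / 2)) := by
    rw [measureReal_def, InnerProductSpace.volume_ball, ENNReal.ofReal_one, one_pow, one_mul,
      ENNReal.toReal_ofReal (by positivity), Real.Gamma_add_one (by positivity),
      Real.sqrt_eq_rpow, ← Real.rpow_natCast, ← Real.rpow_mul Real.pi_pos.le]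
    congr 2
    ring
  have hΓ : 0 < Real.Gamma ((d : ℝ) / 2) := Real.Gamma_pos_of_pos (by positivity)
  rw [hvol, nsmul_eq_mul, Complex.real_smul, leadCoeff]
  norm_cast
  field_simp

end Model

/-! ### Leading terms as `t → 0⁺` -/

lemma rpow_sub_rpow_le {a b M p : ℝ} (hp : 1 ≤ p) (hb : 0 ≤ b) (hab : b ≤ a) (haM : a ≤ M) :
    a ^ p - b ^ p ≤ p * M ^ (p - 1) * (a - b) := by
  rcases (hb.trans hab).eq_or_lt with ha | ha
  · have : b = 0 := le_antisymm (by linarith) hb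
    simp [← ha, this]
  have h1 := one_add_mul_self_le_rpow_one_add (s := b / a - 1)
    (by have := div_nonneg hb ha.le; linarith) hp
  rw [add_sub_cancel, Real.div_rpow hb ha.le, le_div_iff₀ (by positivity)] at h1
  have h2 : a ^ p = a ^ (p - 1) * a := by
    rw [← Real.rpow_add_one ha.ne', sub_add_cancel]
  have h3 : (1 + p * (b / a - 1)) * a ^ p = a ^ p - p * a ^ (p - 1) * (a - b) := by
    rw [h2]; field_simp; ring
  have h4 : a ^ (p - 1) ≤ M ^ (p - 1) := Real.rpow_le_rpow ha.le haM (by linarith)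
  have h5 : p * a ^ (p - 1) * (a - b) ≤ p * M ^ (p - 1) * (a - b) :=
    mul_le_mul_of_nonneg_right (mul_le_mul_of_nonneg_left h4 (by linarith)) (by linarith)
  linarith

lemma abs_max_rpow_sub_le {a b M p : ℝ} (hp : 1 ≤ p) (ha : a ≤ M) (hb : b ≤ M) (hM : 0 ≤ M) :
    |max a 0 ^ p - max b 0 ^ p| ≤ p * M ^ (p - 1) * |a - b| := by
  wlog hab : b ≤ a generalizing a b
  · rw [abs_sub_comm, abs_sub_comm a b]
    exact this hb ha (not_le.1 hab).le
  have hmax : max b 0 ≤ max a 0 := max_le_max_right 0 hab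
  rw [abs_of_nonneg (sub_nonneg.2 (Real.rpow_le_rpow (le_max_right _ _) hmax (by linarith))),
    abs_of_nonneg (sub_nonneg.2 hab)]
  refine (rpow_sub_rpow_le hp (le_max_right _ _) hmax (max_le ha hM)).trans
    (mul_le_mul_of_nonneg_left ?_ (by positivity))
  have := max_sub_max_le_max a 0 b 0
  simpa [max_eq_left (sub_nonneg.2 hab)] using this

lemma norm_gsFun_sub_le {a b M p : ℝ} (hp : 1 ≤ p) (ha : a ≤ M) (hb : b ≤ M) (hM : 0 ≤ M) :
    ‖gsFun p a - gsFun p b‖ ≤ p / Real.Gamma (p + 1) * M ^ (p - 1) * |a - b| := by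
  have hΓ : 0 < Real.Gamma (p + 1) := Real.Gamma_pos_of_pos (by linarith)
  rw [gsFun_ofReal (by linarith), gsFun_ofReal (by linarith), ← Complex.ofReal_sub,
    Complex.norm_real, Real.norm_eq_abs, ← sub_div, abs_div, abs_of_pos hΓ, div_le_iff₀ hΓ]
  refine (abs_max_rpow_sub_le hp ha hb hM).trans_eq ?_
  field_simp

namespace SquaredPhase

variable {E : Type*} [NormedAddCommGroup E] [InnerProductSpace ℝ E] {P : SquaredPhase E}

/-- For small times the domain of integration `{q < t²}` lies in a ball of radius `O(t)`. -/
lemma exists_norm_le_mul (P : SquaredPhase E) :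
    ∃ δ > 0, ∀ t, 0 < t → t ^ 2 < δ → ∀ x, P.q x < t ^ 2 → ‖x‖ ≤ 2 / P.n₀ * t := by
  obtain ⟨C, r, hr, hC⟩ := P.near_source
  have hn := P.n₀_pos
  set r₁ := min r (P.n₀ ^ 2 / (2 * (|C| + 1))) with hr₁
  have hr₁0 : 0 < r₁ := lt_min hr (by positivity)
  obtain ⟨δ, hδ, hoff⟩ := P.off_source r₁ hr₁0
  refine ⟨δ, hδ, fun t ht htδ x hx => ?_⟩
  have hxr : ‖x‖ ≤ r₁ := by
    by_contra hcon
    linarith [hoff x (not_le.1 hcon).le]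
  have h1 := (abs_le.1 (hC x (hxr.trans (min_le_left _ _)))).1
  have hx0 := norm_nonneg x
  have h2 : C * ‖x‖ ≤ P.n₀ ^ 2 / 2 := by
    calc C * ‖x‖ ≤ (|C| + 1) * ‖x‖ :=
          mul_le_mul_of_nonneg_right ((le_abs_self C).trans (by linarith)) hx0
      _ ≤ (|C| + 1) * (P.n₀ ^ 2 / (2 * (|C| + 1))) :=
          mul_le_mul_of_nonneg_left (hxr.trans (min_le_right _ _)) (by positivity)
      _ = P.n₀ ^ 2 / 2 := by field_simp
  have h3 : C * ‖x‖ ^ 3 ≤ P.n₀ ^ 2 / 2 * ‖x‖ ^ 2 := by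
    calc C * ‖x‖ ^ 3 = C * ‖x‖ * ‖x‖ ^ 2 := by ring
      _ ≤ _ := mul_le_mul_of_nonneg_right h2 (by positivity)
  have h4 : (P.n₀ * ‖x‖) ^ 2 ≤ (2 * t) ^ 2 := by nlinarith
  have h5 : P.n₀ * ‖x‖ ≤ 2 * t := le_of_sq_le_sq h4 (by positivity)
  rw [div_mul_eq_mul_div, le_div_iff₀ hn]
  linarith

lemma zero_mem_U (P : SquaredPhase E) : (0 : E) ∈ P.U := by
  obtain ⟨C, r, hr, hC⟩ := P.near_source
  have h : P.q 0 = 0 := by simpa using hC 0 (by simpa using hr.le)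
  simp only [U, mem_ofPred_eq, h]
  exact pow_pos P.T_pos 2

lemma IsAmplitude.differentiableAt_zero {ψ : E → ℝ} (hψ : P.IsAmplitude ψ) :
    DifferentiableAt ℝ ψ 0 :=
  (hψ.1.contDiffAt (P.isOpen_U.mem_nhds P.zero_mem_U)).differentiableAt (by simp)

lemma eventually_mem_Ioo (P : SquaredPhase E) : ∀ᶠ t in 𝓝[>] (0 : ℝ), t ∈ Ioo 0 P.T :=
  Ioo_mem_nhdsGT P.T_pos

variable [FiniteDimensional ℝ E] [MeasurableSpace E] [BorelSpace E]

variable (P) in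
/-- The leading behaviour of the continued pairing at exponent `p` as `t → 0⁺`. -/
def HasLeadingTerm (p : ℝ) (ψ : E → ℝ) : Prop :=
  (fun t : ℝ => P.gsCont p t ψ - ((leadCoeff (Module.finrank ℝ E) P.n₀ p * ψ 0 *
    t ^ ((Module.finrank ℝ E : ℝ) + 2 * p) : ℝ) : ℂ)) =O[𝓝[>] (0 : ℝ)]
    fun t : ℝ => t ^ ((Module.finrank ℝ E : ℝ) + 2 * p + 1)

/-- For `p ≥ 1` the function `f₊^p` is locally Lipschitz, and the pairing is compared directly with
that for the homogeneous medium of slowness `n₀` and constant amplitude `ψ 0`. -/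
lemma IsAmplitude.hasLeadingTerm_of_one_le [Nontrivial E] {ψ : E → ℝ} (hψ : P.IsAmplitude ψ)
    {p : ℝ} (hp : 1 ≤ p) : P.HasLeadingTerm p ψ := by
  have hp0 : 0 < p := by linarith
  have hn := P.n₀_pos
  obtain ⟨C, r, hr, hC⟩ := P.near_source
  obtain ⟨δ, hδ, hloc⟩ := P.exists_norm_le_mul
  obtain ⟨C', hC'0, hC'⟩ := hψ.differentiableAt_zero.isBigO_sub.exists_pos
  obtain ⟨r', hr', hball⟩ := Metric.eventually_nhds_iff_ball.1 hC'.bound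
  have hψ0 : ∀ x, ‖x‖ < r' → |ψ x - ψ 0| ≤ C' * ‖x‖ := fun x hx => by
    simpa using hball x (mem_ball_zero_iff.2 hx)
  set L := 2 / P.n₀ with hL
  have hL0 : 0 < L := by positivity
  set d := Module.finrank ℝ E with hd
  set K := p / Real.Gamma (p + 1) with hK
  have hΓ : 0 < Real.Gamma (p + 1) := Real.Gamma_pos_of_pos (by linarith)
  have hK0 : 0 < K := by positivity
  set B := |ψ 0| + C' * r' with hB
  set Q := K * (|C| * L ^ 3) * B + C' * L / Real.Gamma (p + 1) with hQ
  have hsmall : ∀ᶠ t in 𝓝[>] (0 : ℝ), L * t < min r r' ∧ t ^ 2 < δ := by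
    have h1 : Tendsto (fun t : ℝ => L * t) (𝓝[>] 0) (𝓝 0) := by
      have : Continuous fun t : ℝ => L * t := by fun_prop
      simpa using (this.tendsto 0).mono_left nhdsWithin_le_nhds
    have h2 : Tendsto (fun t : ℝ => t ^ 2) (𝓝[>] 0) (𝓝 0) := by
      have : Continuous fun t : ℝ => t ^ 2 := by fun_prop
      simpa using (this.tendsto 0).mono_left nhdsWithin_le_nhds
    exact (h1.eventually_lt_const (lt_min hr hr')).and (h2.eventually_lt_const hδ)
  refine IsBigO.of_bound (Q * (L ^ d * (volume : Measure E).real (Metric.ball 0 1))) ?_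
  filter_upwards [P.eventually_mem_Ioo, hsmall] with t ht ⟨htr, htδ⟩
  have ht0 : 0 < t := ht.1
  have hLt : 0 ≤ L * t := by positivity
  have htT := sq_lt_sq_T ht
  have hp1 : -1 < (p : ℂ).re := by rw [Complex.ofReal_re]; linarith
  have hcont : Continuous (gsFun p) := continuous_gsFun (by rwa [Complex.ofReal_re])
  have hmodel : ∀ x : E, L * t < ‖x‖ → t ^ 2 - P.n₀ ^ 2 * ‖x‖ ^ 2 ≤ 0 := fun x hx => by
    have : 2 * t < P.n₀ * ‖x‖ := by
      rw [hL, div_mul_eq_mul_div, div_lt_iff₀ hn] at hx; linarith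
    nlinarith
  have hi1 := hψ.integrable_gsFun_mul hp1 ht0 htT
  have hi2 : Integrable fun x : E => gsFun p (t ^ 2 - P.n₀ ^ 2 * ‖x‖ ^ 2) * (ψ 0 : ℂ) := by
    refine Continuous.integrable_of_hasCompactSupport (by fun_prop)
      (HasCompactSupport.of_support_subset_isCompact (isCompact_closedBall (0 : E) (L * t))
        fun x hx => ?_)
    rw [mem_closedBall_zero_iff]
    by_contra hcon
    exact hx (by simp [gsFun_of_nonpos (hmodel x (not_le.1 hcon))])
  have hdiff : P.gsCont p t ψ - ((leadCoeff d P.n₀ p * ψ 0 * t ^ ((d : ℝ) + 2 * p) : ℝ) : ℂ) =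
      ∫ x in Metric.closedBall (0 : E) (L * t), (gsFun p (t ^ 2 - P.q x) * (ψ x : ℂ) -
        gsFun p (t ^ 2 - P.n₀ ^ 2 * ‖x‖ ^ 2) * (ψ 0 : ℂ)) := by
    rw [setIntegral_eq_integral_of_forall_compl_eq_zero, integral_sub hi1 hi2,
      integral_mul_const, integral_gsFun_norm_sq hn hp0 ht0, gsCont_eq_gsIntegral ht0 htT hψ hp1,
      gsIntegral]
    · push_cast; ring
    · intro x hx
      rw [mem_closedBall_zero_iff, not_le] at hx
      have : t ^ 2 - P.q x ≤ 0 := by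
        by_contra hcon
        linarith [hloc t ht0 htδ x (by linarith)]
      rw [gsFun_of_nonpos this, gsFun_of_nonpos (hmodel x hx)]
      simp
  have hpt : ∀ x ∈ Metric.closedBall (0 : E) (L * t), ‖gsFun p (t ^ 2 - P.q x) * (ψ x : ℂ) -
      gsFun p (t ^ 2 - P.n₀ ^ 2 * ‖x‖ ^ 2) * (ψ 0 : ℂ)‖ ≤ Q * t ^ (2 * p + 1) := fun x hx => by
    rw [mem_closedBall_zero_iff] at hx
    have hxr : ‖x‖ ≤ r := hx.trans (htr.le.trans (min_le_left _ _))
    have hxr' : ‖x‖ < r' := hx.trans_lt (htr.trans_le (min_le_right _ _))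
    have hψx := hψ0 x hxr'
    have hψB : ‖(ψ x : ℂ)‖ ≤ B := by
      rw [Complex.norm_real, Real.norm_eq_abs]
      have e1 : |ψ x| ≤ |ψ 0| + |ψ x - ψ 0| := by
        simpa using abs_add_le (ψ 0) (ψ x - ψ 0)
      have e2 : C' * ‖x‖ ≤ C' * r' := mul_le_mul_of_nonneg_left hxr'.le hC'0.le
      linarith
    have hsplit : gsFun p (t ^ 2 - P.q x) * (ψ x : ℂ) -
        gsFun p (t ^ 2 - P.n₀ ^ 2 * ‖x‖ ^ 2) * (ψ 0 : ℂ) =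
        (gsFun p (t ^ 2 - P.q x) - gsFun p (t ^ 2 - P.n₀ ^ 2 * ‖x‖ ^ 2)) * (ψ x : ℂ) +
        gsFun p (t ^ 2 - P.n₀ ^ 2 * ‖x‖ ^ 2) * ((ψ x - ψ 0 : ℝ) : ℂ) := by
      push_cast; ring
    have hb2 : t ^ 2 - P.n₀ ^ 2 * ‖x‖ ^ 2 ≤ t ^ 2 := sub_le_self _ (by positivity)
    have h1 := norm_gsFun_sub_le hp (sub_le_self (t ^ 2) (P.q_nonneg x)) hb2 (sq_nonneg t)
    have h2 : |(t ^ 2 - P.q x) - (t ^ 2 - P.n₀ ^ 2 * ‖x‖ ^ 2)| ≤ |C| * L ^ 3 * t ^ 3 := by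
      rw [show (t ^ 2 - P.q x) - (t ^ 2 - P.n₀ ^ 2 * ‖x‖ ^ 2) =
        -(P.q x - P.n₀ ^ 2 * ‖x‖ ^ 2) by ring, abs_neg]
      calc _ ≤ C * ‖x‖ ^ 3 := hC x hxr
        _ ≤ |C| * (L * t) ^ 3 := mul_le_mul (le_abs_self C)
            (pow_le_pow_left₀ (norm_nonneg x) hx 3) (by positivity) (abs_nonneg C)
        _ = _ := by ring
    have h3 : ‖gsFun p (t ^ 2 - P.n₀ ^ 2 * ‖x‖ ^ 2)‖ ≤ (t ^ 2) ^ p / Real.Gamma (p + 1) := by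
      rw [gsFun_ofReal hp0, Complex.norm_of_nonneg (by positivity)]
      exact div_le_div_of_nonneg_right (Real.rpow_le_rpow (le_max_right _ _)
        (max_le hb2 (sq_nonneg t)) hp0.le) hΓ.le
    have h4 : ‖((ψ x - ψ 0 : ℝ) : ℂ)‖ ≤ C' * (L * t) := by
      rw [Complex.norm_real, Real.norm_eq_abs]
      exact hψx.trans (mul_le_mul_of_nonneg_left hx hC'0.le)
    have e1 : (t ^ 2) ^ (p - 1) * t ^ 3 = t ^ (2 * p + 1) := by
      rw [← Real.rpow_natCast t 2, ← Real.rpow_mul ht0.le, ← Real.rpow_natCast t 3,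
        ← Real.rpow_add ht0]
      congr 1; push_cast; ring
    have e2 : (t ^ 2) ^ p * t = t ^ (2 * p + 1) := by
      rw [← Real.rpow_natCast t 2, ← Real.rpow_mul ht0.le, ← Real.rpow_add_one ht0.ne']
      congr 1
    rw [hsplit]
    refine (norm_add_le _ _).trans ?_
    rw [norm_mul, norm_mul]
    have hM : 0 ≤ K * (t ^ 2) ^ (p - 1) := by positivity
    calc _ ≤ (K * (t ^ 2) ^ (p - 1) * (|C| * L ^ 3 * t ^ 3)) * B +
          (t ^ 2) ^ p / Real.Gamma (p + 1) * (C' * (L * t)) :=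
        add_le_add
          (mul_le_mul (h1.trans (mul_le_mul_of_nonneg_left h2 hM)) hψB (norm_nonneg _)
            (by positivity))
          (mul_le_mul h3 h4 (norm_nonneg _) (by positivity))
      _ = K * (|C| * L ^ 3) * B * ((t ^ 2) ^ (p - 1) * t ^ 3) +
          C' * L / Real.Gamma (p + 1) * ((t ^ 2) ^ p * t) := by ring
      _ = Q * t ^ (2 * p + 1) := by rw [e1, e2, hQ]; ring
  rw [hdiff]
  refine (norm_setIntegral_le_of_norm_le_const measure_closedBall_lt_top hpt).trans_eq ?_
  rw [Measure.addHaar_real_closedBall _ _ hLt, Real.norm_of_nonneg (by positivity), mul_pow,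
    show (d : ℝ) + 2 * p + 1 = (d : ℝ) + (2 * p + 1) by ring, Real.rpow_add ht0 (d : ℝ),
    Real.rpow_natCast]
  ring

lemma leadCoeff_eq_mul_add_one {d : ℕ} {n₀ p : ℝ} :
    leadCoeff d n₀ p = (p + 1 + d / 2) * leadCoeff d n₀ (p + 1) := by
  rw [leadCoeff, leadCoeff, show p + 1 + 1 + (d : ℝ) / 2 = p + 1 + d / 2 + 1 by ring]
  rcases eq_or_ne (p + 1 + (d : ℝ) / 2) 0 with h | h
  -- at a pole both sides vanish, in accordance with `1 / Γ = 0` there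
  · rw [h, Real.Gamma_zero, mul_zero, div_zero, zero_mul]
  · rw [Real.Gamma_add_one h, mul_left_comm (n₀ ^ d), ← mul_div_assoc, mul_div_mul_left _ _ h]

/-- The value at the source of `½ ∇ · (ψ W)`. It is forced by the recursion, on comparing the
leading terms at the exponents `1` and `2`. -/
lemma IsAmplitude.dilation_zero [Nontrivial E] {ψ : E → ℝ} (hψ : P.IsAmplitude ψ) :
    P.dilation ψ 0 = (Module.finrank ℝ E : ℝ) / 2 * ψ 0 := by
  set d := Module.finrank ℝ E with hd
  set e : ℝ := (d : ℝ) + 2 * 1 + 2 with he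
  set κ := leadCoeff d P.n₀ 2 with hκ
  have hκ0 : 0 < κ := by
    have := P.n₀_pos
    have : 0 < Real.Gamma (2 + 1 + (d : ℝ) / 2) := Real.Gamma_pos_of_pos (by positivity)
    rw [hκ, leadCoeff]; positivity
  have hκ1 : leadCoeff d P.n₀ 1 = (2 + d / 2) * κ := by
    rw [leadCoeff_eq_mul_add_one]; norm_num [hκ]
  have h1 := hψ.hasLeadingTerm_of_one_le (p := 1) le_rfl
  have h2 := hψ.hasLeadingTerm_of_one_le (p := 2) one_le_two
  have h3 := hψ.dilation.hasLeadingTerm_of_one_le (p := 2) one_le_two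
  simp only [HasLeadingTerm, ← hd, hκ1, ← hκ] at h1 h2 h3
  have e2 : (d : ℝ) + 2 * 2 = e := by rw [he]; ring
  simp only [e2] at h2 h3
  have hpow : ∀ t : ℝ, 0 < t → t ^ 2 * t ^ ((d : ℝ) + 2 * 1) = t ^ e := fun t ht => by
    rw [he, ← Real.rpow_natCast t 2, ← Real.rpow_add ht]; congr 1; push_cast; ring
  have h1' : (fun t : ℝ => (t : ℂ) ^ 2 * (P.gsCont (1 : ℝ) t ψ - (((2 + d / 2) * κ * ψ 0 *
      t ^ ((d : ℝ) + 2 * 1) : ℝ) : ℂ))) =O[𝓝[>] (0 : ℝ)] fun t : ℝ => t ^ (e + 1) := by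
    have hsq : (fun t : ℝ => (t : ℂ) ^ 2) =O[𝓝[>] (0 : ℝ)] fun t : ℝ => t ^ 2 :=
      IsBigO.of_bound 1 (Eventually.of_forall fun t => by simp)
    refine (hsq.mul h1).congr' EventuallyEq.rfl ?_
    filter_upwards [self_mem_nhdsWithin] with t ht
    have ht : 0 < t := ht
    rw [Real.rpow_add_one ht.ne', ← mul_assoc, hpow t ht, ← Real.rpow_add_one ht.ne']
  have hcomb := ((h2.const_mul_left 2).add h3).sub h1'
  have hconst : (fun t : ℝ => ((κ * (d / 2 * ψ 0 - P.dilation ψ 0) * t ^ e : ℝ) : ℂ))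
      =O[𝓝[>] (0 : ℝ)] fun t : ℝ => t ^ (e + 1) := by
    refine hcomb.congr' ?_ EventuallyEq.rfl
    filter_upwards [P.eventually_mem_Ioo] with t ht
    have hrec := sq_mul_gsCont ht.1 (sq_lt_sq_T ht) hψ (1 : ℝ)
    have h11 : ((1 : ℝ) : ℂ) + 1 = ((2 : ℝ) : ℂ) := by push_cast; norm_num
    rw [h11] at hrec
    rw [← hpow t ht.1]
    push_cast at hrec ⊢
    linear_combination -hrec
  have hlim : Tendsto (fun _ : ℝ => κ * (d / 2 * ψ 0 - P.dilation ψ 0)) (𝓝[>] (0 : ℝ)) (𝓝 0) := by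
    obtain ⟨c, hc⟩ := hconst.bound
    have hid : Tendsto (fun t : ℝ => c * t) (𝓝[>] 0) (𝓝 0) := by
      have : Continuous fun t : ℝ => c * t := by fun_prop
      simpa using (this.tendsto 0).mono_left nhdsWithin_le_nhds
    refine squeeze_zero_norm' ?_ hid
    filter_upwards [hc, self_mem_nhdsWithin] with t h (ht : 0 < t)
    have hte : 0 < t ^ e := by positivity
    rw [Complex.norm_real, norm_mul _ (t ^ e), Real.rpow_add_one ht.ne', norm_mul (t ^ e) t,
      Real.norm_of_nonneg hte.le, Real.norm_of_nonneg ht.le] at h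
    refine le_of_mul_le_mul_right (h.trans_eq ?_) hte
    ring
  have h0 := tendsto_nhds_unique tendsto_const_nhds hlim
  rcases mul_eq_zero.1 h0 with h | h
  · exact absurd h hκ0.ne'
  · linarith

/-- The recursion carries the leading term from large exponents to all real ones. -/
lemma IsAmplitude.hasLeadingTerm [Nontrivial E] {ψ : E → ℝ} (hψ : P.IsAmplitude ψ) (p : ℝ) :
    P.HasLeadingTerm p ψ := by
  obtain ⟨k, hk⟩ := exists_nat_ge (1 - p)
  induction k generalizing p ψ with
  | zero => exact hψ.hasLeadingTerm_of_one_le (by simpa using hk)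
  | succ k ih =>
    push_cast at hk
    have h1 := ih hψ (p + 1) (by linarith)
    have h2 := ih hψ.dilation (p + 1) (by linarith)
    simp only [HasLeadingTerm] at h1 h2 ⊢
    set d := Module.finrank ℝ E with hd
    have hsq : (fun t : ℝ => ((t : ℂ) ^ 2)⁻¹) =O[𝓝[>] (0 : ℝ)] fun t : ℝ => (t ^ 2)⁻¹ :=
      IsBigO.of_bound 1 (Eventually.of_forall fun t => by simp)
    have h3 := hsq.mul ((h1.const_mul_left ((p : ℂ) + 1)).add h2)
    have hpow : ∀ t : ℝ, 0 < t → t ^ ((d : ℝ) + 2 * (p + 1)) = t ^ 2 * t ^ ((d : ℝ) + 2 * p) :=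
      fun t ht => by
        rw [← Real.rpow_natCast t 2, ← Real.rpow_add ht]; congr 1; push_cast; ring
    refine h3.congr' ?_ ?_
    · filter_upwards [P.eventually_mem_Ioo] with t ht
      have ht' : (t : ℂ) ≠ 0 := Complex.ofReal_ne_zero.2 ht.1.ne'
      have hrec := sq_mul_gsCont ht.1 (sq_lt_sq_T ht) hψ p
      have hp1 : ((p + 1 : ℝ) : ℂ) = (p : ℂ) + 1 := by push_cast; rfl
      rw [hp1, hψ.dilation_zero, ← hd, hpow t ht.1, leadCoeff_eq_mul_add_one (p := p),
        inv_mul_eq_iff_eq_mul₀ (pow_ne_zero 2 ht')]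
      push_cast
      linear_combination -hrec
    · filter_upwards [self_mem_nhdsWithin] with t (ht : 0 < t)
      rw [Real.rpow_add_one ht.ne', hpow t ht, Real.rpow_add_one ht.ne']
      field_simp

end SquaredPhase

/-! ### Application to Hadamard's ansatz -/

section Medium

variable {m : ℕ} {ρ ν : EuclideanSpace ℝ (Fin m) → ℝ}

lemma slowness_pos (hρ : ∀ x, 0 < ρ x) (hν : ∀ x, 0 < ν x) (x : EuclideanSpace ℝ (Fin m)) :
    0 < slowness ρ ν x := Real.sqrt_pos.2 (div_pos (hρ x) (hν x))

lemma slowness_sq (hρ : ∀ x, 0 < ρ x) (hν : ∀ x, 0 < ν x) (x : EuclideanSpace ℝ (Fin m)) :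
    slowness ρ ν x ^ 2 = ρ x / ν x := Real.sq_sqrt (div_pos (hρ x) (hν x)).le

lemma waveSpeed_eq_inv_slowness (x : EuclideanSpace ℝ (Fin m)) :
    waveSpeed ρ ν x = (slowness ρ ν x)⁻¹ := by
  rw [waveSpeed, slowness, ← Real.sqrt_inv, inv_div]

/-- In a caustic-free medium `τ²`, with the field `W = (ν / 2ρ) ∇τ²`, is a squared phase: by the
eikonal equation `|∇τ²|² = 4 (ρ/ν) τ²`. -/
lemma exists_squaredPhase (hρ : AnalyticOnNhd ℝ ρ univ) (hν : AnalyticOnNhd ℝ ν univ)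
    (hρ_pos : ∀ x, 0 < ρ x) (hν_pos : ∀ x, 0 < ν x) {T : ℝ} (hT : CausticFree ρ ν T) :
    ∃ P : SquaredPhase (EuclideanSpace ℝ (Fin m)), (∀ x, P.q x = travelTime ρ ν x ^ 2) ∧
      P.T = T ∧ P.n₀ = slowness ρ ν 0 ∧ P.U = sourceNhd ρ ν T := by
  have hρC : ContDiff ℝ ∞ ρ := contDiffOn_univ.1 (hρ.contDiffOn uniqueDiffOn_univ)
  have hνC : ContDiff ℝ ∞ ν := contDiffOn_univ.1 (hν.contDiffOn uniqueDiffOn_univ)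
  have hn := slowness_pos hρ_pos hν_pos
  have hnC : ContDiff ℝ ∞ (slowness ρ ν) :=
    (hρC.div hνC fun x => (hν_pos x).ne').sqrt fun x => (div_pos (hρ_pos x) (hν_pos x)).ne'
  have hc : Continuous (slowness ρ ν) := hnC.continuous
  have hτc : Continuous (travelTime ρ ν) := continuous_leastTime hn hc
  have hτ0 : ∀ x, 0 ≤ travelTime ρ ν x := leastTime_nonneg hn
  set q : EuclideanSpace ℝ (Fin m) → ℝ := fun x => travelTime ρ ν x ^ 2 with hq
  have hU : {x | q x < T ^ 2} = sourceNhd ρ ν T := by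
    ext x
    exact sq_lt_sq₀ (hτ0 x) hT.1.le
  have hopen : IsOpen {x | q x < T ^ 2} := isOpen_lt (hτc.pow 2) continuous_const
  have hqC : ContDiffOn ℝ ∞ q {x | q x < T ^ 2} := hU ▸ hT.2
  set b := EuclideanSpace.basisFun (Fin m) ℝ
  refine ⟨{
    q := q
    W := fun x => (ν x / (2 * ρ x)) • ∑ i, fderiv ℝ q x (b i) • b i
    T := T
    n₀ := slowness ρ ν 0
    T_pos := hT.1
    n₀_pos := hn 0
    q_nonneg := fun x => sq_nonneg _
    continuous_q := hτc.pow 2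
    contDiffOn_q := hqC
    contDiffOn_W := ?_
    fderiv_q_W := fun x hx => ?_
    near_source := exists_abs_leastTime_sq_sub_le hn hc (hnC.differentiable (by simp) 0)
    off_source := fun r hr => ?_ }, fun _ => rfl, rfl, rfl, hU⟩
  · have h1 : ContDiff ℝ ∞ fun x => ν x / (2 * ρ x) :=
      hνC.div (contDiff_const.mul hρC) fun x => (mul_pos two_pos (hρ_pos x)).ne'
    refine h1.contDiffOn.smul (ContDiffOn.sum fun i _ => ContDiffOn.fun_smul ?_ contDiffOn_const)
    exact (hqC.fderiv_of_isOpen hopen (by simp)).clm_apply contDiffOn_const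
  · have hd : DifferentiableAt ℝ q x :=
      (hqC.contDiffAt (hopen.mem_nhds hx)).differentiableAt (by simp)
    have heik : ‖fderiv ℝ q x‖ ^ 2 = 4 * slowness ρ ν x ^ 2 * q x :=
      norm_fderiv_leastTime_sq hn hc hd
    have hsum : ∑ i, fderiv ℝ q x (b i) * fderiv ℝ q x (b i) = ‖fderiv ℝ q x‖ ^ 2 := by
      set g := (InnerProductSpace.toDual ℝ _).symm (fderiv ℝ q x) with hg
      have hgi : ∀ v, fderiv ℝ q x v = inner ℝ g v := fun v => by
        rw [hg, InnerProductSpace.toDual_symm_apply]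
      have hgn : ‖g‖ = ‖fderiv ℝ q x‖ := LinearIsometryEquiv.norm_map _ _
      rw [← hgn, ← b.sum_sq_norm_inner_left g]
      refine Finset.sum_congr rfl fun i _ => ?_
      rw [hgi, Real.norm_eq_abs, sq_abs, sq]
    have hρx := hρ_pos x
    have hνx := hν_pos x
    rw [map_smul, map_sum]
    simp only [map_smul, smul_eq_mul]
    rw [hsum, heik, slowness_sq hρ_pos hν_pos]
    field_simp
    ring
  · obtain ⟨δ, hδ, h⟩ := exists_pos_le_leastTime hn hc hr
    exact ⟨δ ^ 2, pow_pos hδ 2, fun x hx => pow_le_pow_left₀ hδ.le (h x hx) 2⟩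

end Medium

/-- A test function equal to one at the origin. -/
lemma exists_testFunction_zero_eq_one (m : ℕ) :
    ∃ φ : 𝓓((⊤ : TopologicalSpace.Opens (EuclideanSpace ℝ (Fin m))), ℝ), φ 0 = 1 := by
  let f : ContDiffBump (0 : EuclideanSpace ℝ (Fin m)) := ⟨1, 2, one_pos, one_lt_two⟩
  exact ⟨⟨f, f.contDiff, f.hasCompactSupport, subset_univ _⟩,
    f.one_of_mem_closedBall (Metric.mem_closedBall_self zero_le_one)⟩

section Pairing

variable {m : ℕ} {ρ ν v₀ : EuclideanSpace ℝ (Fin m) → ℝ}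
  {P : SquaredPhase (EuclideanSpace ℝ (Fin m))}
  {φ : 𝓓((⊤ : TopologicalSpace.Opens (EuclideanSpace ℝ (Fin m))), ℝ)}

lemma isAmplitude_mul_testFunction (hv₀ : ContDiffOn ℝ ∞ v₀ P.U) :
    P.IsAmplitude fun x => v₀ x * φ x := by
  refine ⟨hv₀.mul φ.contDiff.contDiffOn, ?_⟩
  obtain ⟨R, hR⟩ := φ.hasCompactSupport.isCompact.isBounded.exists_norm_le
  refine ⟨R, fun x hx => ?_⟩
  have : x ∉ tsupport φ := fun h => absurd (hR x h) (not_le.2 hx)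
  simp [image_eq_zero_of_notMem_tsupport this]

lemma isGSPairing_gsCont (hq : ∀ x, P.q x = travelTime ρ ν x ^ 2) {ψ : EuclideanSpace ℝ (Fin m) → ℝ}
    (hψ : P.IsAmplitude ψ) {t : ℝ} (ht : t ∈ Ioo 0 P.T) :
    IsGSPairing (phase ρ ν t) ψ fun z => P.gsCont z t ψ := by
  have hT := SquaredPhase.sq_lt_sq_T ht
  refine ⟨SquaredPhase.differentiable_gsCont ht.1 hT hψ, fun z hz => ?_⟩
  have hph : ∀ x, phase ρ ν t x = t ^ 2 - P.q x := fun x => by rw [phase, hq]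
  simp only [hph]
  exact ⟨hψ.integrable_gsFun_mul hz ht.1 hT, SquaredPhase.gsCont_eq_gsIntegral ht.1 hT hψ hz⟩

lemma leadingTerm_eq_gsCont (hq : ∀ x, P.q x = travelTime ρ ν x ^ 2)
    (hv₀ : ContDiffOn ℝ ∞ v₀ P.U) {t : ℝ} (ht : t ∈ Ioo 0 P.T) :
    leadingTerm ρ ν v₀ t φ = P.gsCont (-((m : ℂ) - 1) / 2) t fun x => v₀ x * φ x := by
  have h := isGSPairing_gsCont hq (isAmplitude_mul_testFunction (φ := φ) hv₀) ht
  have hex : ∃ F, IsGSPairing (phase ρ ν t) (fun x => v₀ x * φ x) F := ⟨_, h⟩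
  rw [leadingTerm, gsPairing, dif_pos hex]
  exact congrFun (hex.choose_spec.unique h) _

lemma hasDerivAt_leadingTerm (hq : ∀ x, P.q x = travelTime ρ ν x ^ 2)
    (hv₀ : ContDiffOn ℝ ∞ v₀ P.U) {t : ℝ} (ht : t ∈ Ioo 0 P.T) :
    HasDerivAt (fun s : ℝ => leadingTerm ρ ν v₀ s φ)
      (2 * t * P.gsCont (-((m : ℂ) - 1) / 2 - 1) t fun x => v₀ x * φ x) t := by
  have h := SquaredPhase.hasDerivAt_gsCont_add_one ht
    (isAmplitude_mul_testFunction (φ := φ) hv₀) (-((m : ℂ) - 1) / 2 - 1)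
  rw [sub_add_cancel] at h
  refine h.congr_of_eventuallyEq ?_
  filter_upwards [Ioo_mem_nhds ht.1 ht.2] with s hs using leadingTerm_eq_gsCont hq hv₀ hs

/-- The amplitude of the initial data of Hadamard's leading term. -/
lemma leadCoeff_hadamard {n₀ : ℝ} :
    leadCoeff m n₀ (-((m : ℝ) - 1) / 2) = 2 * n₀⁻¹ ^ m * Real.pi ^ (((m : ℝ) - 1) / 2) := by
  rw [leadCoeff, show -((m : ℝ) - 1) / 2 + 1 + m / 2 = 1 / 2 + 1 by ring,
    Real.Gamma_add_one (by norm_num), Real.Gamma_one_half_eq, Real.sqrt_eq_rpow,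
    show (m : ℝ) / 2 = ((m : ℝ) - 1) / 2 + 1 / 2 by ring, Real.rpow_add Real.pi_pos, inv_pow]
  have : 0 < Real.pi ^ (1 / 2 : ℝ) := by positivity
  field_simp

lemma leadCoeff_hadamard_sub_one {n₀ : ℝ} :
    2 * leadCoeff m n₀ (-((m : ℝ) - 1) / 2 - 1) =
      2 * n₀⁻¹ ^ m * Real.pi ^ (((m : ℝ) - 1) / 2) := by
  rw [leadCoeff, show -((m : ℝ) - 1) / 2 - 1 + 1 + m / 2 = 1 / 2 by ring,
    Real.Gamma_one_half_eq, Real.sqrt_eq_rpow,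
    show (m : ℝ) / 2 = ((m : ℝ) - 1) / 2 + 1 / 2 by ring, Real.rpow_add Real.pi_pos, inv_pow]
  have : 0 < Real.pi ^ (1 / 2 : ℝ) := by positivity
  field_simp

lemma leadingTerm_sub_isBigO (hm : 1 ≤ m) (hq : ∀ x, P.q x = travelTime ρ ν x ^ 2)
    (hn₀ : P.n₀ = slowness ρ ν 0) (hv₀ : ContDiffOn ℝ ∞ v₀ P.U) :
    (fun t : ℝ => leadingTerm ρ ν v₀ t φ -
      ((2 * waveSpeed ρ ν 0 ^ m * Real.pi ^ (((m : ℝ) - 1) / 2) * v₀ 0 * φ 0 * t : ℝ) : ℂ))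
      =O[𝓝[>] (0 : ℝ)] fun t : ℝ => t ^ 2 := by
  have : Nonempty (Fin m) := ⟨⟨0, hm⟩⟩
  have h := (isAmplitude_mul_testFunction (φ := φ) hv₀).hasLeadingTerm (-((m : ℝ) - 1) / 2)
  rw [SquaredPhase.HasLeadingTerm, finrank_euclideanSpace_fin, leadCoeff_hadamard, hn₀,
    show (m : ℝ) + 2 * (-((m : ℝ) - 1) / 2) = 1 by ring, one_add_one_eq_two] at h
  refine h.congr' ?_ (Eventually.of_forall fun t => Real.rpow_two t)
  filter_upwards [P.eventually_mem_Ioo] with t ht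
  rw [leadingTerm_eq_gsCont hq hv₀ ht, waveSpeed_eq_inv_slowness, Real.rpow_one]
  push_cast
  ring_nf

lemma leadingTermDot_sub_isBigO (hm : 1 ≤ m) (hq : ∀ x, P.q x = travelTime ρ ν x ^ 2)
    (hn₀ : P.n₀ = slowness ρ ν 0) (hv₀ : ContDiffOn ℝ ∞ v₀ P.U) :
    (fun t : ℝ => leadingTermDot ρ ν v₀ t φ -
      ((2 * waveSpeed ρ ν 0 ^ m * Real.pi ^ (((m : ℝ) - 1) / 2) * v₀ 0 * φ 0 : ℝ) : ℂ))
      =O[𝓝[>] (0 : ℝ)] fun t : ℝ => t := by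
  have : Nonempty (Fin m) := ⟨⟨0, hm⟩⟩
  have h := (isAmplitude_mul_testFunction (φ := φ) hv₀).hasLeadingTerm (-((m : ℝ) - 1) / 2 - 1)
  rw [SquaredPhase.HasLeadingTerm, finrank_euclideanSpace_fin, hn₀,
    show (m : ℝ) + 2 * (-((m : ℝ) - 1) / 2 - 1) = -1 by ring, neg_add_cancel] at h
  have h2 : (fun t : ℝ => (2 * t : ℂ)) =O[𝓝[>] (0 : ℝ)] fun t : ℝ => t :=
    IsBigO.of_bound 2 (Eventually.of_forall fun t => by simp)
  refine (h2.mul h).congr' ?_ (Eventually.of_forall fun t => by simp)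
  filter_upwards [P.eventually_mem_Ioo] with t ht
  have ht' : (t : ℂ) ≠ 0 := Complex.ofReal_ne_zero.2 ht.1.ne'
  rw [leadingTermDot, (hasDerivAt_leadingTerm hq hv₀ ht).deriv, waveSpeed_eq_inv_slowness,
    ← leadCoeff_hadamard_sub_one, Real.rpow_neg_one]
  push_cast
  field_simp

end Pairing

lemma tendsto_of_sub_isBigO {f : ℝ → ℂ} {g : ℝ → ℝ} {c : ℂ}
    (h : (fun t => f t - c) =O[𝓝[>] (0 : ℝ)] g) (hg : Tendsto g (𝓝[>] 0) (𝓝 0)) :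
    Tendsto f (𝓝[>] 0) (𝓝 c) := by
  simpa using (h.trans_tendsto hg).add_const c

end HadamardAnsatz

theorem mainTheorem1 (m : ℕ) (hm : 1 ≤ m)
    (ρ ν : EuclideanSpace ℝ (Fin m) → ℝ)
    (hρ : AnalyticOnNhd ℝ ρ Set.univ) (hν : AnalyticOnNhd ℝ ν Set.univ)
    (hρ_pos : ∀ x, 0 < ρ x) (hν_pos : ∀ x, 0 < ν x)
    (T : ℝ) (hT : HadamardAnsatz.CausticFree ρ ν T)
    (v₀ : EuclideanSpace ℝ (Fin m) → ℝ)
    (hv₀ : ContDiffOn ℝ ∞ v₀ (HadamardAnsatz.sourceNhd ρ ν T)) :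
    -- the generalized function `G₀(t,·)` is well defined, and differentiable in `t`
    (∀ φ : 𝓓((⊤ : TopologicalSpace.Opens (EuclideanSpace ℝ (Fin m))), ℝ), ∀ t ∈ Set.Ioo 0 T,
      (∃ F, HadamardAnsatz.IsGSPairing (HadamardAnsatz.phase ρ ν t) (fun x => v₀ x * φ x) F) ∧
      DifferentiableAt ℝ (fun s : ℝ => HadamardAnsatz.leadingTerm ρ ν v₀ s φ) t) ∧
    -- the two limits
    HadamardAnsatz.TendstoZero (HadamardAnsatz.leadingTerm ρ ν v₀) ∧
    HadamardAnsatz.TendstoDelta (HadamardAnsatz.leadingTermDot ρ ν v₀)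
      (2 * HadamardAnsatz.waveSpeed ρ ν 0 ^ m * Real.pi ^ (((m : ℝ) - 1) / 2) * v₀ 0) ∧
    -- the remainders
    (∀ φ : 𝓓((⊤ : TopologicalSpace.Opens (EuclideanSpace ℝ (Fin m))), ℝ),
      (fun t : ℝ => HadamardAnsatz.leadingTerm ρ ν v₀ t φ -
          ((2 * HadamardAnsatz.waveSpeed ρ ν 0 ^ m * Real.pi ^ (((m : ℝ) - 1) / 2) * v₀ 0 *
            φ 0 * t : ℝ) : ℂ)) =O[𝓝[>] (0 : ℝ)] (fun t : ℝ => t ^ 2) ∧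
      (fun t : ℝ => HadamardAnsatz.leadingTermDot ρ ν v₀ t φ -
          ((2 * HadamardAnsatz.waveSpeed ρ ν 0 ^ m * Real.pi ^ (((m : ℝ) - 1) / 2) * v₀ 0 *
            φ 0 : ℝ) : ℂ)) =O[𝓝[>] (0 : ℝ)] (fun t : ℝ => t)) ∧
    -- the Green's function initial data are met exactly for one value of `v₀(0)`
    ((HadamardAnsatz.TendstoZero (HadamardAnsatz.leadingTerm ρ ν v₀) ∧
        HadamardAnsatz.TendstoDelta (HadamardAnsatz.leadingTermDot ρ ν v₀) (1 / ρ 0)) ↔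
      v₀ 0 = HadamardAnsatz.slowness ρ ν 0 ^ m / (2 * ρ 0 * Real.pi ^ (((m : ℝ) - 1) / 2))) ∧
    -- the equivalent forms of this value
    HadamardAnsatz.slowness ρ ν 0 ^ m / (2 * ρ 0 * Real.pi ^ (((m : ℝ) - 1) / 2)) =
      1 / (2 * ρ 0 * HadamardAnsatz.waveSpeed ρ ν 0 ^ m * Real.pi ^ (((m : ℝ) - 1) / 2)) ∧
    HadamardAnsatz.slowness ρ ν 0 ^ m / (2 * ρ 0 * Real.pi ^ (((m : ℝ) - 1) / 2)) =
      1 / (2 * ν 0 * HadamardAnsatz.waveSpeed ρ ν 0 ^ ((m : ℤ) - 2) *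
        Real.pi ^ (((m : ℝ) - 1) / 2)) ∧
    HadamardAnsatz.slowness ρ ν 0 ^ m / (2 * ρ 0 * Real.pi ^ (((m : ℝ) - 1) / 2)) =
      HadamardAnsatz.slowness ρ ν 0 ^ ((m : ℤ) - 2) /
        (2 * ν 0 * Real.pi ^ (((m : ℝ) - 1) / 2)) := by
  obtain ⟨P, hq, hPT, hn₀, hU⟩ :=
    HadamardAnsatz.exists_squaredPhase hρ hν hρ_pos hν_pos hT
  rw [← hU] at hv₀
  subst hPT
  set A : ℝ := 2 * HadamardAnsatz.waveSpeed ρ ν 0 ^ m * Real.pi ^ (((m : ℝ) - 1) / 2) with hA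
  have hO : ∀ φ : 𝓓((⊤ : TopologicalSpace.Opens (EuclideanSpace ℝ (Fin m))), ℝ), _ := fun φ =>
    HadamardAnsatz.leadingTerm_sub_isBigO (φ := φ) hm hq hn₀ hv₀
  have hOd : ∀ φ : 𝓓((⊤ : TopologicalSpace.Opens (EuclideanSpace ℝ (Fin m))), ℝ), _ := fun φ =>
    HadamardAnsatz.leadingTermDot_sub_isBigO (φ := φ) hm hq hn₀ hv₀
  have hid : Tendsto (fun t : ℝ => t) (𝓝[>] 0) (𝓝 0) := nhdsWithin_le_nhds
  have hsq : Tendsto (fun t : ℝ => t ^ 2) (𝓝[>] 0) (𝓝 0) := by simpa using hid.pow 2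
  have hzero : HadamardAnsatz.TendstoZero (HadamardAnsatz.leadingTerm ρ ν v₀) := fun φ => by
    have h1 : Tendsto (fun t : ℝ => HadamardAnsatz.leadingTerm ρ ν v₀ t φ -
        ((A * v₀ 0 * φ 0 * t : ℝ) : ℂ)) (𝓝[>] 0) (𝓝 0) := (hO φ).trans_tendsto hsq
    have h2 : Tendsto (fun t : ℝ => ((A * v₀ 0 * φ 0 * t : ℝ) : ℂ)) (𝓝[>] 0) (𝓝 0) := by
      have : Continuous fun t : ℝ => ((A * v₀ 0 * φ 0 * t : ℝ) : ℂ) := by fun_prop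
      simpa using (this.tendsto 0).mono_left nhdsWithin_le_nhds
    simpa only [sub_add_cancel, add_zero] using h1.add h2
  have hdelta : HadamardAnsatz.TendstoDelta (HadamardAnsatz.leadingTermDot ρ ν v₀) (A * v₀ 0) :=
    fun φ => HadamardAnsatz.tendsto_of_sub_isBigO (hOd φ) hid
  have hn : 0 < HadamardAnsatz.slowness ρ ν 0 := HadamardAnsatz.slowness_pos hρ_pos hν_pos 0
  have hn2 := HadamardAnsatz.slowness_sq hρ_pos hν_pos 0
  have hc : HadamardAnsatz.waveSpeed ρ ν 0 = (HadamardAnsatz.slowness ρ ν 0)⁻¹ :=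
    HadamardAnsatz.waveSpeed_eq_inv_slowness 0
  have hρ0 := hρ_pos 0
  have hν0 := hν_pos 0
  have hπ : 0 < Real.pi ^ (((m : ℝ) - 1) / 2) := by positivity
  -- the source condition `A v₀(0) = 1 / ρ₀`, solved for `v₀(0)`
  have hiff : A * v₀ 0 = 1 / ρ 0 ↔ v₀ 0 =
      HadamardAnsatz.slowness ρ ν 0 ^ m / (2 * ρ 0 * Real.pi ^ (((m : ℝ) - 1) / 2)) := by
    rw [hA, hc, inv_pow, eq_div_iff hρ0.ne', eq_div_iff (by positivity)]
    field_simp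
  have hρn : ρ 0 = HadamardAnsatz.slowness ρ ν 0 ^ 2 * ν 0 := by
    rw [hn2]; field_simp
  refine ⟨fun φ t ht => ⟨⟨_, HadamardAnsatz.isGSPairing_gsCont hq
    (HadamardAnsatz.isAmplitude_mul_testFunction hv₀) ht⟩,
    (HadamardAnsatz.hasDerivAt_leadingTerm hq hv₀ ht).differentiableAt⟩, hzero, hdelta,
    fun φ => ⟨hO φ, hOd φ⟩, ⟨fun h => ?_, fun h => ⟨hzero, ?_⟩⟩, ?_, ?_, ?_⟩
  · obtain ⟨φ, hφ⟩ := HadamardAnsatz.exists_testFunction_zero_eq_one m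
    have huniq := tendsto_nhds_unique (hdelta φ) (h.2 φ)
    rw [hφ, mul_one, mul_one] at huniq
    exact hiff.1 (Complex.ofReal_injective huniq)
  · rw [← hiff.2 h]
    exact hdelta
  · rw [hc, inv_pow]
    field_simp
  · rw [hc, inv_zpow, zpow_sub₀ hn.ne', hρn, zpow_natCast]
    norm_cast
    field_simp
  · rw [zpow_sub₀ hn.ne', hρn, zpow_natCast]
    norm_cast
    field_simp
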